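/- **Theorem (exact solution of the Jaynes–Cummings model).** Let $\mathfrak h_S$ be a two-dimensional complex Hilbert space with orthonormal basis $|\mathtt g\rangle,|\mathtt e\rangle$, let $\mathfrak f$ be a complex Hilbert space (the one-particle space of the bath), and let $\Gamma(\mathfrak f)$ be the Bose Fock space over $\mathfrak f$, with vacuum $|\mathrm{vac}\rangle$, exponential vectors $|e^f\rangle=\bigoplus_n f^{\otimes n}/\sqrt{n!}$, annihilation and creation operators $a(g),a(g)^*$, and differential second quantization $d\Gamma$. Let $h$ be a self-adjoint operator on $\mathfrak f$, let $g\in\mathfrak f$ and $\omega_0\in\mathbb R$, and put $H=\omega_0|\mathtt e\rangle\langle\mathtt e|$, $L=|\mathtt g\rangle\langle\mathtt e|$, $$H_{\mathrm{Tot}}=H\otimes I+I\otimes d\Gamma(h)+iL\otimes a(g)^*-iL^*\otimes a(g),\qquad H_0=H\otimes I+I\otimes d\Gamma(h).$$ Let $g_t=e^{it(h-\omega_0)}g$, let $K(t,s)=\langle g_t|g_s\rangle$, and for $f\in\mathfrak f$ let $\zeta_t=\zeta_t(f)=\langle f|g_t\rangle$ be the complex trajectory of $f$. Inner products are linear in the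 second argument. Let $\phi\in\mathfrak h_S$. The Schrödinger equation $\dot\Phi_t=-iH_{\mathrm{Tot}}\Phi_t$, $\Phi_0=\phi\otimes\mathrm{vac}$, has exactly one strong solution on $[0,\infty)$ with values in the domain of $H_{\mathrm{Tot}}$ (the intersection of the domains of its four terms), and for every strongly continuous unitary group $e^{itH_{\mathrm{Tot}}}$ whose generator extends $H_{\mathrm{Tot}}$ one has $\Phi_t=e^{-itH_{\mathrm{Tot}}}(\phi\otimes\mathrm{vac})$ for $t\ge 0$. Let $U_t(\phi\otimes\mathrm{vac})=e^{itH_0}\Phi_t$ be the state in the interaction picture, and let $|\Psi_t(\zeta)\rangle\in\mathfrak h_S$ be its complex wave representation, that is, $\langle\psi|\Psi_t(\zeta)\rangle=\langle\psi\otimes e^f|U_t(\phi\otimes\mathrm{vac})\rangle$ for all $\psi\in\mathfrak h_S$. Then for all $t\ge 0$ and all $f\in\mathfrak f$, $$|\Psi_t(\zeta)\rangle=|\phi\rangle+\langle\mathtt e|\phi\rangle\Big((\lambda(t)-1)|\mathtt e\rangle+\int_0^t\zeta_\tau\lambda(\tau)\,d\tau\,|\mathtt g\rangle\Big),$$ where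 $\lambda(t)=\sum_{k=0}^\infty(-1)^kI_k(t)$, $I_0(t)=1$, and for $k\ge1$ $$I_k(t)=\int_{t\ge\tau_{2k}>\tau_{2k-1}>\cdots>\tau_1\ge0}K(\tau_{2k},\tau_{2k-1})\cdots K(\tau_2,\tau_1)\,d\tau_{2k}\cdots d\tau_1 ;$$ the series for $\lambda(t)$ and all the integrals converge absolutely. -/

import Mathlib

open scoped TensorProduct

namespace OpenQS

noncomputable section

universe u

/-! ### Strongly continuous unitary groups and unbounded operators -/

/-- A strongly continuous one-parameter unitary group `t ↦ V t` on a complex inner product space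
(each `V t` is isometric, with inverse `V (-t)`). -/
structure UnitaryGroup (H : Type u) [NormedAddCommGroup H] [InnerProductSpace ℂ H] where
  toFun : ℝ → H →ₗᵢ[ℂ] H
  map_zero' : toFun 0 = LinearIsometry.id
  map_add' : ∀ s t, toFun (s + t) = (toFun s).comp (toFun t)
  continuous' : ∀ x, Continuous fun t => toFun t x

instance {H : Type u} [NormedAddCommGroup H] [InnerProductSpace ℂ H] :
    CoeFun (UnitaryGroup H) (fun _ => ℝ → H →ₗᵢ[ℂ] H) := ⟨UnitaryGroup.toFun⟩

/-- The generator `A` of a unitary group `V t = e^{itA}`: its domain is the set of all `x` for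
which `t ↦ V t x` is differentiable at `0`, and `A x = -i (d/dt) V t x` at `t = 0`.
(On a Hilbert space, `V ↦ V.generator` is a bijection onto the self-adjoint operators.) -/
def UnitaryGroup.generator {H : Type u} [NormedAddCommGroup H] [InnerProductSpace ℂ H]
    (V : UnitaryGroup H) : H →ₗ.[ℂ] H where
  domain :=
    { carrier := {x | DifferentiableAt ℝ (fun t => V t x) 0}
      add_mem' := by
        intro x y hx hy
        have : (fun t => V t (x + y)) = fun t => V t x + V t y := by ext t; simp
        simp only [Set.mem_ofPred_eq] at hx hy ⊢
        rw [this]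
        exact hx.add hy
      zero_mem' := by simp
      smul_mem' := by
        intro c x hx
        have : (fun t => V t (c • x)) = fun t => c • V t x := by ext t; simp
        simp only [Set.mem_ofPred_eq] at hx ⊢
        rw [this]
        exact hx.const_smul c }
  toFun :=
    { toFun := fun x => (-Complex.I) • deriv (fun t => V t (x : H)) 0
      map_add' := by
        rintro ⟨x, hx⟩ ⟨y, hy⟩
        have h : (fun t => V t (x + y)) = fun t => V t x + V t y := by ext t; simp
        have hd : deriv (fun t => V t x + V t y) 0
            = deriv (fun t => V t x) 0 + deriv (fun t => V t y) 0 := deriv_fun_add hx hy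
        simp only [Submodule.coe_add]
        rw [h, hd, smul_add]
      map_smul' := by
        rintro c ⟨x, hx⟩
        have h : (fun t => V t (c • x)) = fun t => c • V t x := by ext t; simp
        have hd : deriv (fun t => c • V t x) 0 = c • deriv (fun t => V t x) 0 :=
          (HasDerivAt.const_smul c (DifferentiableAt.hasDerivAt hx)).deriv
        simp only [Submodule.coe_smul, RingHom.id_apply]
        rw [h, hd, smul_comm] }

/-- `Φ` is a (strong) solution on `[0, ∞)` of the Schrödinger equation `dΦ/dt = -i A Φ` with
initial value `x`, for an unbounded operator `A`. -/
def IsSchrodingerSolution {H : Type u} [NormedAddCommGroup H] [InnerProductSpace ℂ H]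
    (A : H →ₗ.[ℂ] H) (x : H) (Φ : ℝ → H) : Prop :=
  Φ 0 = x ∧ ∀ t, 0 ≤ t → ∃ ht : Φ t ∈ A.domain,
    HasDerivWithinAt Φ ((-Complex.I) • A ⟨Φ t, ht⟩) (Set.Ici 0) t

/-- The operator `X ⊗ A` for `X` everywhere defined and `A` unbounded; its domain is
the algebraic tensor product of the whole space with the domain of `A`. -/
def tensorPMap {S H : Type*} [NormedAddCommGroup S] [InnerProductSpace ℂ S]
    [NormedAddCommGroup H] [InnerProductSpace ℂ H] (X : S →L[ℂ] S) (A : H →ₗ.[ℂ] H) :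
    (S ⊗[ℂ] H) →ₗ.[ℂ] (S ⊗[ℂ] H) where
  domain := LinearMap.range (A.domain.subtype.lTensor S)
  toFun := (TensorProduct.map (X : S →ₗ[ℂ] S) A.toFun) ∘ₗ
    ((LinearEquiv.ofInjective (A.domain.subtype.lTensor S)
      (Module.Flat.lTensor_preserves_injective_linearMap A.domain.subtype
        A.domain.injective_subtype)).symm : _ →ₗ[ℂ] S ⊗[ℂ] A.domain)

/-- `(X ⊗ A) (s ⊗ x) = X s ⊗ A x`. -/
theorem tensorPMap_tmul {S H : Type*} [NormedAddCommGroup S] [InnerProductSpace ℂ S]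
    [NormedAddCommGroup H] [InnerProductSpace ℂ H] (X : S →L[ℂ] S) (A : H →ₗ.[ℂ] H)
    (s : S) (x : A.domain) (h : s ⊗ₜ[ℂ] (x : H) ∈ (tensorPMap X A).domain) :
    tensorPMap X A ⟨s ⊗ₜ[ℂ] (x : H), h⟩ = X s ⊗ₜ[ℂ] A x := by
  have hinj := Module.Flat.lTensor_preserves_injective_linearMap (M := S) A.domain.subtype
    A.domain.injective_subtype
  have : (LinearEquiv.ofInjective (A.domain.subtype.lTensor S) hinj).symm
      ⟨s ⊗ₜ[ℂ] (x : H), h⟩ = s ⊗ₜ[ℂ] x := by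
    rw [LinearEquiv.symm_apply_eq]
    ext
    simp
  refine (congrArg (TensorProduct.map (X : S →ₗ[ℂ] S) A.toFun) this).trans ?_
  simp

/-! ### Bose Fock space -/

/-- A bundled complex inner product space. -/
structure PreHilb : Type (u + 1) where
  carrier : Type u
  [normed : NormedAddCommGroup carrier]
  [inner : InnerProductSpace ℂ carrier]

attribute [instance] PreHilb.normed PreHilb.inner

/-- The algebraic tensor powers of `F` (`ℂ` for `n = 0`, and `F ⊗ F^{⊗ n}` for `n + 1`) with
their inner products. -/
def tensorPower (F : Type u) [NormedAddCommGroup F] [InnerProductSpace ℂ F] : ℕ → PreHilb.{u}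
  | 0 => ⟨EuclideanSpace ℂ PUnit.{u + 1}⟩
  | n + 1 => ⟨F ⊗[ℂ] (tensorPower F n).carrier⟩

/-- The underlying space of the `n`-th algebraic tensor power. -/
abbrev TPow (F : Type u) [NormedAddCommGroup F] [InnerProductSpace ℂ F] (n : ℕ) : Type u :=
  (tensorPower F n).carrier

section Fock

variable {F : Type u} [NormedAddCommGroup F] [InnerProductSpace ℂ F]

/-- `f^{⊗ n}`. -/
def powVec (f : F) : (n : ℕ) → TPow F n
  | 0 => (EuclideanSpace.single PUnit.unit (1 : ℂ) : EuclideanSpace ℂ PUnit.{u + 1})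
  | n + 1 => (f ⊗ₜ[ℂ] powVec f n : F ⊗[ℂ] TPow F n)

theorem inner_powVec (f g : F) (n : ℕ) :
    inner ℂ (powVec f n) (powVec g n) = inner ℂ f g ^ n := by
  induction n with
  | zero =>
    change inner ℂ (EuclideanSpace.single PUnit.unit (1 : ℂ) : EuclideanSpace ℂ PUnit.{u + 1})
      (EuclideanSpace.single PUnit.unit (1 : ℂ)) = _
    simp
  | succ n ih =>
    change inner ℂ (f ⊗ₜ[ℂ] powVec f n : F ⊗[ℂ] TPow F n) (g ⊗ₜ[ℂ] powVec g n) = _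
    rw [TensorProduct.inner_tmul, ih, pow_succ']

theorem norm_powVec (f : F) (n : ℕ) : ‖powVec f n‖ = ‖f‖ ^ n := by
  have h : ((‖powVec f n‖ ^ 2 : ℝ) : ℂ) = (((‖f‖ ^ n) ^ 2 : ℝ) : ℂ) := by
    have := inner_powVec f f n
    rw [inner_self_eq_norm_sq_to_K, inner_self_eq_norm_sq_to_K] at this
    push_cast
    rw [← pow_mul, mul_comm n 2, pow_mul]
    exact this
  have h' := Complex.ofReal_injective h
  exact (pow_left_inj₀ (norm_nonneg _) (by positivity) two_ne_zero).1 h'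

/-- The contraction `x ⊗ T ↦ ⟨g|x⟩ T`. -/
def contract (g : F) (n : ℕ) : TPow F (n + 1) →L[ℂ] TPow F n :=
  show F ⊗[ℂ] TPow F n →L[ℂ] TPow F n from
    (TensorProduct.lidIsometry ℂ (TPow F n)).toLinearIsometry.toContinuousLinearMap ∘L
      (innerSL ℂ g).rTensor (TPow F n)

theorem contract_powVec (f g : F) (n : ℕ) :
    contract g n (powVec f (n + 1)) = inner ℂ g f • powVec f n := by
  change TensorProduct.lid ℂ _ ((innerSL ℂ g).rTensor (TPow F n) (f ⊗ₜ[ℂ] powVec f n)) = _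
  simp

/-- `u ⊗ ⋯ ⊗ u` for an isometry `u`. -/
def tensorMap (u : F →ₗᵢ[ℂ] F) : (n : ℕ) → TPow F n →ₗᵢ[ℂ] TPow F n
  | 0 => LinearIsometry.id
  | n + 1 => (TensorProduct.mapIsometry u (tensorMap u n) :
      F ⊗[ℂ] TPow F n →ₗᵢ[ℂ] F ⊗[ℂ] TPow F n)

theorem tensorMap_powVec (u : F →ₗᵢ[ℂ] F) (f : F) (n : ℕ) :
    tensorMap u n (powVec f n) = powVec (u f) n := by
  induction n with
  | zero => rfl
  | succ n ih =>
    change TensorProduct.mapIsometry u (tensorMap u n) (f ⊗ₜ[ℂ] powVec f n) = _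
    simp only [TensorProduct.mapIsometry_apply, TensorProduct.map_tmul]
    exact congrArg (fun v => (u f ⊗ₜ[ℂ] v : F ⊗[ℂ] TPow F n)) ih

variable (F) in
/-- The Hilbert space of `n` bosons as a subspace of the completed `n`-th tensor power: the closed
linear span of the vectors `f^{⊗ n}`, that is, the space of all symmetric tensors. -/
def symSub (n : ℕ) : Submodule ℂ (UniformSpace.Completion (TPow F n)) :=
  (Submodule.span ℂ (Set.range fun f : F =>
    (powVec f n : UniformSpace.Completion (TPow F n)))).topologicalClosure

variable (F) in
/-- The Hilbert space of `n` bosons with one-particle space `F`. -/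
def NParticle (n : ℕ) : Type u := symSub F n

instance (n : ℕ) : NormedAddCommGroup (NParticle F n) :=
  inferInstanceAs (NormedAddCommGroup (symSub F n))

instance (n : ℕ) : InnerProductSpace ℂ (NParticle F n) :=
  inferInstanceAs (InnerProductSpace ℂ (symSub F n))

instance (n : ℕ) : CompleteSpace (NParticle F n) :=
  inferInstanceAs (CompleteSpace
    (Submodule.span ℂ (Set.range fun f : F =>
      (powVec f n : UniformSpace.Completion (TPow F n)))).topologicalClosure)

variable (F) in
/-- The Bose Fock space over `F`: the Hilbert space direct sum of all the `n`-boson spaces. -/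
abbrev Fock : Type u := lp (NParticle F) 2

variable (F) in
/-- The inclusion of the `n`-boson space into the completed `n`-th tensor power. -/
def NParticle.incl (n : ℕ) : NParticle F n →ₗᵢ[ℂ] UniformSpace.Completion (TPow F n) :=
  (symSub F n).subtypeₗᵢ

/-- `f^{⊗ n}` as an element of the `n`-boson space. -/
def symPow (f : F) (n : ℕ) : NParticle F n :=
  ⟨(powVec f n : UniformSpace.Completion (TPow F n)),
    Submodule.le_topologicalClosure _ (Submodule.subset_span ⟨f, rfl⟩)⟩

theorem norm_symPow (f : F) (n : ℕ) : ‖symPow f n‖ = ‖f‖ ^ n :=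
  (UniformSpace.Completion.norm_coe _).trans (norm_powVec f n)

theorem inner_symPow (f g : F) (n : ℕ) :
    inner ℂ (symPow f n) (symPow g n) = inner ℂ f g ^ n :=
  (UniformSpace.Completion.inner_coe _ _).trans (inner_powVec f g n)

/-- The vectors `f^{⊗ n}` span a dense subspace of the `n`-boson space. -/
theorem mem_of_symPow_mem {n : ℕ} (p : Submodule ℂ (NParticle F n))
    (hp : IsClosed (p : Set (NParticle F n))) (h : ∀ f, symPow f n ∈ p) (x : NParticle F n) :
    x ∈ p := by
  have hcl : IsClosed ((p.map (NParticle.incl F n).toLinearMap : Submodule ℂ _) :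
      Set (UniformSpace.Completion (TPow F n))) := by
    rw [Submodule.map_coe]
    exact (NParticle.incl F n).isometry.isClosedEmbedding.isClosedMap _ hp
  have hle : symSub F n ≤ p.map (NParticle.incl F n).toLinearMap := by
    refine Submodule.topologicalClosure_minimal _ (Submodule.span_le.2 ?_) hcl
    rintro _ ⟨f, rfl⟩
    exact ⟨symPow f n, h f, rfl⟩
  obtain ⟨y, hy, hyx⟩ := hle (x : symSub F n).2
  exact (NParticle.incl F n).injective hyx ▸ hy

/-- The exponential vector `e^f`, with components `f^{⊗ n} / √n!`. -/
def expVec (f : F) : Fock F :=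
  ⟨fun n => ((Real.sqrt n.factorial)⁻¹ : ℂ) • symPow f n, by
    refine memℓp_gen ?_
    have h : (fun n : ℕ => ‖((Real.sqrt n.factorial)⁻¹ : ℂ) • symPow f n‖ ^ (2 : ENNReal).toReal)
        = fun n : ℕ => (‖f‖ ^ 2) ^ n / n.factorial := by
      ext n
      rw [norm_smul, norm_symPow]
      simp only [ENNReal.toReal_ofNat, Real.rpow_ofNat, norm_inv, Complex.norm_real,
        Real.norm_eq_abs, mul_pow, inv_pow, sq_abs]
      rw [Real.sq_sqrt (by positivity), ← pow_mul, ← pow_mul, mul_comm 2 n, div_eq_inv_mul]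
    rw [h]
    exact Real.summable_pow_div_factorial _⟩

/-- `⟨e^f | e^g⟩ = e^{⟨f|g⟩}`. -/
theorem inner_expVec (f g : F) :
    inner ℂ (expVec f) (expVec g) = Complex.exp (inner ℂ f g) := by
  rw [lp.inner_eq_tsum, Complex.exp_eq_exp_ℂ, NormedSpace.exp_eq_tsum_div]
  refine tsum_congr fun n => ?_
  change inner ℂ (((Real.sqrt n.factorial)⁻¹ : ℂ) • symPow f n)
    (((Real.sqrt n.factorial)⁻¹ : ℂ) • symPow g n) = _
  rw [inner_smul_left, inner_smul_right, inner_symPow, ← mul_assoc]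
  have : (starRingEnd ℂ) ((Real.sqrt n.factorial)⁻¹ : ℂ) * ((Real.sqrt n.factorial)⁻¹ : ℂ)
      = ((n.factorial : ℂ))⁻¹ := by
    rw [map_inv₀, Complex.conj_ofReal, ← mul_inv, ← Complex.ofReal_mul,
      Real.mul_self_sqrt (by positivity)]
    simp
  rw [this, div_eq_inv_mul]

variable (F) in
/-- The Fock vacuum `1 ⊕ 0 ⊕ 0 ⊕ ⋯`. -/
def vac : Fock F := lp.single 2 0 (symPow 0 0)

/-- The contraction `x₁ ⊗ ⋯ ⊗ x_{n+1} ↦ ⟨g|x₁⟩ x₂ ⊗ ⋯ ⊗ x_{n+1}` on symmetric tensors. -/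
def symContract (g : F) (n : ℕ) : NParticle F (n + 1) →L[ℂ] NParticle F n :=
  ((contract g n).completion.comp (symSub F (n + 1)).subtypeL).codRestrict (symSub F n) (by
    have hle : symSub F (n + 1) ≤ (symSub F n).comap
        ((contract g n).completion : UniformSpace.Completion (TPow F (n + 1)) →ₗ[ℂ]
          UniformSpace.Completion (TPow F n)) := by
      refine Submodule.topologicalClosure_minimal _ (Submodule.span_le.2 ?_) ?_
      · rintro _ ⟨f, rfl⟩
        have : (contract g n).completion
            (powVec f (n + 1) : UniformSpace.Completion (TPow F (n + 1)))
            = inner ℂ g f • (powVec f n : UniformSpace.Completion (TPow F n)) := by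
          rw [ContinuousLinearMap.completion_apply_coe, contract_powVec,
            UniformSpace.Completion.coe_smul]
        simp only [SetLike.mem_coe, Submodule.mem_comap]
        change (contract g n).completion _ ∈ _
        rw [this]
        exact (symSub F n).smul_mem _ (symPow f n).2
      · exact (Submodule.isClosed_topologicalClosure _).preimage
          (contract g n).completion.continuous
    exact fun x => hle x.2)

theorem symContract_symPow (g f : F) (n : ℕ) :
    symContract g n (symPow f (n + 1)) = inner ℂ g f • symPow f n := by
  apply Subtype.ext
  change (contract g n).completion (powVec f (n + 1) : UniformSpace.Completion (TPow F (n + 1)))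
    = inner ℂ g f • (powVec f n : UniformSpace.Completion (TPow F n))
  rw [ContinuousLinearMap.completion_apply_coe, contract_powVec,
    UniformSpace.Completion.coe_smul]

/-- The annihilation operator `a(g)`, `(a(g) Ψ)_n = √(n+1) ⟨g| Ψ_{n+1}`, on its maximal domain. -/
def annihilation (g : F) : Fock F →ₗ.[ℂ] Fock F where
  domain :=
    { carrier := {Ψ | Memℓp (fun n : ℕ =>
        ((Real.sqrt (n + 1) : ℝ) : ℂ) • symContract g n (Ψ (n + 1))) 2}
      add_mem' := by
        intro Ψ Φ hΨ hΦ
        simp only [Set.mem_ofPred_eq] at hΨ hΦ ⊢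
        convert hΨ.add hΦ using 1
        ext1 n
        simp
      zero_mem' := by
        simp only [Set.mem_ofPred_eq]
        convert zero_memℓp (E := NParticle F) (p := 2) using 1
        ext1 n
        simp
      smul_mem' := by
        intro c Ψ hΨ
        simp only [Set.mem_ofPred_eq] at hΨ ⊢
        convert hΨ.const_smul c using 1
        ext1 n
        simp only [lp.coeFn_smul, Pi.smul_apply, map_smul]
        rw [smul_comm] }
  toFun :=
    { toFun := fun Ψ => ⟨fun n : ℕ =>
        ((Real.sqrt (n + 1) : ℝ) : ℂ) • symContract g n ((Ψ : Fock F) (n + 1)), Ψ.2⟩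
      map_add' := by
        intro Ψ Φ
        ext n : 2
        simp
        rfl
      map_smul' := by
        intro c Ψ
        ext n : 2
        simp only [Submodule.coe_smul, lp.coeFn_smul, Pi.smul_apply, map_smul, RingHom.id_apply]
        rw [smul_comm] }

/-- The creation operator `a(g)*`, the adjoint of the annihilation operator. -/
def creation (g : F) : Fock F →ₗ.[ℂ] Fock F := (annihilation g).adjoint

/-- `u ⊗ ⋯ ⊗ u` on the `n`-boson space. -/
def symMap (u : F →ₗᵢ[ℂ] F) (n : ℕ) : NParticle F n →ₗᵢ[ℂ] NParticle F n where
  toLinearMap :=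
    (((tensorMap u n).toContinuousLinearMap.completion.comp (symSub F n).subtypeL).codRestrict
      (symSub F n) (by
        have hle : symSub F n ≤ (symSub F n).comap
            ((tensorMap u n).toContinuousLinearMap.completion :
              UniformSpace.Completion (TPow F n) →ₗ[ℂ] UniformSpace.Completion (TPow F n)) := by
          refine Submodule.topologicalClosure_minimal _ (Submodule.span_le.2 ?_) ?_
          · rintro _ ⟨f, rfl⟩
            have : (tensorMap u n).toContinuousLinearMap.completion
                (powVec f n : UniformSpace.Completion (TPow F n))
                = (powVec (u f) n : UniformSpace.Completion (TPow F n)) := by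
              rw [ContinuousLinearMap.completion_apply_coe]
              exact congrArg _ (tensorMap_powVec u f n)
            simp only [SetLike.mem_coe, Submodule.mem_comap]
            change (tensorMap u n).toContinuousLinearMap.completion _ ∈ _
            rw [this]
            exact (symPow (u f) n).2
          · exact (Submodule.isClosed_topologicalClosure _).preimage
              (tensorMap u n).toContinuousLinearMap.completion.continuous
        exact fun x => hle x.2) : symSub F n →ₗ[ℂ] symSub F n)
  norm_map' := by
    intro x
    have key : ∀ y : UniformSpace.Completion (TPow F n),
        ‖(tensorMap u n).toContinuousLinearMap.completion y‖ = ‖y‖ := by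
      intro y
      induction y using UniformSpace.Completion.induction_on with
      | hp =>
        exact isClosed_eq
          ((tensorMap u n).toContinuousLinearMap.completion.continuous.norm) continuous_norm
      | ih a =>
        rw [ContinuousLinearMap.completion_apply_coe, UniformSpace.Completion.norm_coe,
          UniformSpace.Completion.norm_coe]
        exact (tensorMap u n).norm_map a
    exact key x.1

theorem symMap_symPow (u : F →ₗᵢ[ℂ] F) (f : F) (n : ℕ) :
    symMap u n (symPow f n) = symPow (u f) n := by
  apply Subtype.ext
  change (tensorMap u n).toContinuousLinearMap.completion
    (powVec f n : UniformSpace.Completion (TPow F n))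
    = (powVec (u f) n : UniformSpace.Completion (TPow F n))
  rw [ContinuousLinearMap.completion_apply_coe]
  exact congrArg _ (tensorMap_powVec u f n)

/-- The second quantization `Γ(u)`, acting as `u ⊗ ⋯ ⊗ u` on every `n`-boson space. -/
def secondQuantization (u : F →ₗᵢ[ℂ] F) : Fock F →ₗᵢ[ℂ] Fock F where
  toFun Ψ := ⟨fun n => symMap u n (Ψ n), by
    refine memℓp_gen ?_
    simp only [LinearIsometry.norm_map]
    exact (lp.memℓp Ψ).summable (by simp)⟩
  map_add' Ψ Φ := by
    ext n : 2
    simp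
    rfl
  map_smul' c Ψ := by
    ext n : 2
    simp
  norm_map' Ψ := by
    rw [lp.norm_eq_tsum_rpow (by simp), lp.norm_eq_tsum_rpow (by simp)]
    congr 1
    refine tsum_congr fun n => ?_
    exact congrArg (· ^ _) ((symMap u n).norm_map (Ψ n))

@[simp]
theorem secondQuantization_apply (u : F →ₗᵢ[ℂ] F) (Ψ : Fock F) (n : ℕ) :
    secondQuantization u Ψ n = symMap u n (Ψ n) := rfl

theorem continuous_symPow (n : ℕ) : Continuous fun f : F => symPow f n := by
  have h : ∀ n, Continuous fun f : F => powVec f n := by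
    intro n
    induction n with
    | zero => exact continuous_const
    | succ n ih =>
      exact (TensorProduct.continuous_tmul (𝕜 := ℂ) (E := F) (F := TPow F n)).comp
        (continuous_id.prodMk ih)
  exact Continuous.subtype_mk ((UniformSpace.Completion.continuous_coe _).comp (h n)) _

/-- The vectors with continuous orbit form a closed subspace. -/
theorem continuous_orbit {H : Type*} [NormedAddCommGroup H] [InnerProductSpace ℂ H]
    (V : ℝ → H →ₗᵢ[ℂ] H) :
    ∃ p : Submodule ℂ H, IsClosed (p : Set H) ∧ ∀ x, x ∈ p ↔ Continuous fun t => V t x := by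
  refine ⟨{ carrier := {x | Continuous fun t => V t x}
            add_mem' := fun {x y} hx hy => by
              simp only [Set.mem_ofPred_eq, map_add] at *
              exact hx.add hy
            zero_mem' := by simp [continuous_const]
            smul_mem' := fun c x hx => by
              simp only [Set.mem_ofPred_eq, map_smul] at *
              exact hx.const_smul c }, ?_, fun x => Iff.rfl⟩
  refine isClosed_of_closure_subset fun x hx => ?_
  change Continuous fun t => V t x
  refine continuous_of_uniform_approx_of_continuous fun U hU => ?_
  obtain ⟨ε, hε, hεU⟩ := Metric.mem_uniformity_dist.1 hU
  obtain ⟨y, hy, hxy⟩ := Metric.mem_closure_iff.1 hx ε hε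
  refine ⟨fun t => V t y, hy, fun t => hεU ?_⟩
  rwa [(V t).isometry.dist_eq]

/-- If `V t = e^{ith}` then `V.fock t = Γ(e^{ith}) = e^{it dΓ(h)}`. -/
def UnitaryGroup.fock (V : UnitaryGroup F) : UnitaryGroup (Fock F) where
  toFun t := secondQuantization (V t)
  map_zero' := by
    ext Ψ : 1
    ext n : 2
    simp only [secondQuantization_apply, V.map_zero', LinearIsometry.id_apply]
    refine mem_of_symPow_mem (LinearMap.eqLocus (symMap LinearIsometry.id n).toLinearMap
      LinearMap.id) (isClosed_eq (symMap _ n).continuous continuous_id) (fun f => ?_) (Ψ n)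
    exact symMap_symPow _ f n
  map_add' s t := by
    ext Ψ : 1
    ext n : 2
    simp only [secondQuantization_apply, V.map_add']
    refine mem_of_symPow_mem (LinearMap.eqLocus (symMap ((V s).comp (V t)) n).toLinearMap
      ((symMap (V s) n).toLinearMap ∘ₗ (symMap (V t) n).toLinearMap))
      (isClosed_eq (symMap _ n).continuous
        ((symMap (V s) n).continuous.comp (symMap (V t) n).continuous)) (fun f => ?_) (Ψ n)
    change symMap ((V s).comp (V t)) n (symPow f n) = symMap (V s) n (symMap (V t) n (symPow f n))
    rw [symMap_symPow, symMap_symPow, symMap_symPow]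
    rfl
  continuous' Ψ := by
    obtain ⟨p, hpc, hp⟩ := continuous_orbit fun t => secondQuantization (V t)
    have hsingle : ∀ n (x : NParticle F n), lp.single 2 n x ∈ p := by
      intro n x
      rw [hp]
      have heq : (fun t => secondQuantization (V t) (lp.single 2 n x))
          = fun t => lp.single (E := NParticle F) 2 n (symMap (V t) n x) := by
        ext t m : 3
        rw [secondQuantization_apply]
        by_cases h : m = n
        · subst h
          rw [lp.single_apply_self, lp.single_apply_self]
        · rw [lp.single_apply_ne _ _ _ h, lp.single_apply_ne _ _ _ h, map_zero]
      rw [heq]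
      refine (lp.singleContinuousLinearMap ℂ (NParticle F) 2 n).continuous.comp ?_
      obtain ⟨q, hqc, hq⟩ := continuous_orbit fun t => symMap (V t) n
      refine (hq x).1 (mem_of_symPow_mem q hqc (fun f => (hq _).2 ?_) x)
      simp only [symMap_symPow]
      exact (continuous_symPow n).comp (V.continuous' f)
    rw [← hp]
    exact hpc.mem_of_tendsto (lp.hasSum_single (by simp) Ψ)
      (Filter.Eventually.of_forall fun s => p.sum_mem fun i _ => hsingle i _)

/-- The differential second quantization `dΓ(h)` of the generator `h` of `V t = e^{ith}`: the
generator of the unitary group `Γ(e^{ith})`. -/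
def dGamma (V : UnitaryGroup F) : Fock F →ₗ.[ℂ] Fock F := V.fock.generator

end Fock

/-! ### System coupled to a bath -/

section Model

variable {S : Type*} [NormedAddCommGroup S] [InnerProductSpace ℂ S]
variable {F : Type u} [NormedAddCommGroup F] [InnerProductSpace ℂ F]

/-- The total Hamiltonian `H ⊗ I + I ⊗ dΓ(h) + i L ⊗ a(g)* - i L* ⊗ a(g)`, where `h` is the
generator of `V`; its domain is the intersection of the domains of the four terms. -/
def totalHamiltonian [CompleteSpace S] (H L : S →L[ℂ] S) (V : UnitaryGroup F) (g : F) :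
    (S ⊗[ℂ] Fock F) →ₗ.[ℂ] (S ⊗[ℂ] Fock F) :=
  tensorPMap H (LinearMap.toPMap LinearMap.id ⊤)
    + tensorPMap (ContinuousLinearMap.id ℂ S) (dGamma V)
    + Complex.I • tensorPMap L (creation g)
    - Complex.I • tensorPMap (ContinuousLinearMap.adjoint L) (annihilation g)

/-- `e^{itH₀} = e^{itH} ⊗ Γ(e^{ith})` for `H₀ = H ⊗ I + I ⊗ dΓ(h)`. -/
def freeEvolution (H : S →L[ℂ] S) (V : UnitaryGroup F) (t : ℝ) :
    (S ⊗[ℂ] Fock F) →L[ℂ] (S ⊗[ℂ] Fock F) :=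
  TensorProduct.mapL (NormedSpace.exp ((Complex.I * t) • H)) (V.fock t).toContinuousLinearMap

/-- The hybrid complex wave representation: the vector `Ψ̃(f)` of the system space with
`⟨ψ | Ψ̃(f)⟩ = ⟨ψ ⊗ e^f | Ψ⟩` for all `ψ`. -/
def hybridWave (Ψ : S ⊗[ℂ] Fock F) (f : F) : S :=
  TensorProduct.rid ℂ S ((innerSL ℂ (expVec f) : Fock F →ₗ[ℂ] ℂ).lTensor S Ψ)

theorem inner_hybridWave (Ψ : S ⊗[ℂ] Fock F) (f : F) (ψ : S) :
    inner ℂ ψ (hybridWave Ψ f) = inner ℂ (ψ ⊗ₜ[ℂ] expVec f) Ψ := by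
  induction Ψ using TensorProduct.induction_on with
  | zero => simp [hybridWave]
  | tmul s x =>
    simp only [hybridWave, LinearMap.lTensor_tmul, TensorProduct.rid_tmul,
      TensorProduct.inner_tmul, inner_smul_right]
    exact mul_comm _ _
  | add x y hx hy =>
    have : hybridWave (x + y) f = hybridWave x f + hybridWave y f := by simp [hybridWave]
    rw [this, inner_add_right, hx, hy, inner_add_right]

end Model

/-! ### The Jaynes–Cummings model -/

section JC

variable {F : Type u} [NormedAddCommGroup F] [InnerProductSpace ℂ F]

/-- The Jaynes–Cummings Hamiltonian: the total Hamiltonian for the system Hamiltonian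
`H = ω₀ |e⟩⟨e|` and the coupling operator `L = |g⟩⟨e|`. -/
def jcHamiltonian {S : Type*} [NormedAddCommGroup S] [InnerProductSpace ℂ S] [CompleteSpace S]
    (gnd exc : S) (ω₀ : ℝ) (V : UnitaryGroup F) (g : F) :
    (S ⊗[ℂ] Fock F) →ₗ.[ℂ] (S ⊗[ℂ] Fock F) :=
  totalHamiltonian ((ω₀ : ℂ) • InnerProductSpace.rankOne ℂ exc exc)
    (InnerProductSpace.rankOne ℂ gnd exc) V g

/-- `g_t = e^{it(h - ω₀)} g`, where `V t = e^{ith}`. -/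
def mode (V : UnitaryGroup F) (ω₀ : ℝ) (g : F) (t : ℝ) : F :=
  Complex.exp (-(Complex.I * ω₀ * t)) • V t g

/-- The bath correlation function `K(t, s) = ⟨g_t | g_s⟩`. -/
def kernel (V : UnitaryGroup F) (ω₀ : ℝ) (g : F) (t s : ℝ) : ℂ :=
  inner ℂ (mode V ω₀ g t) (mode V ω₀ g s)

/-- The complex trajectory `ζ_t(f) = ⟨f | g_t⟩`. -/
def trajectory (V : UnitaryGroup F) (ω₀ : ℝ) (g f : F) (t : ℝ) : ℂ :=
  inner ℂ f (mode V ω₀ g t)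

/-- The simplex `0 ≤ τ_1 < τ_2 < ⋯ < τ_n ≤ t` (the coordinates are numbered from `0`). -/
def timeSimplex (n : ℕ) (t : ℝ) : Set (Fin n → ℝ) :=
  {τ | StrictMono τ ∧ ∀ i, 0 ≤ τ i ∧ τ i ≤ t}

/-- The integrand `K(τ_{2k}, τ_{2k-1}) ⋯ K(τ_2, τ_1)` (the coordinates are numbered from `0`). -/
def kernelProduct (K : ℝ → ℝ → ℂ) (k : ℕ) (τ : Fin (2 * k) → ℝ) : ℂ :=
  ∏ j : Fin k, K (τ ⟨2 * j + 1, by omega⟩) (τ ⟨2 * j, by omega⟩)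

/-- The time-ordered `2k`-fold integral `I_k(t)` of `K(τ_{2k}, τ_{2k-1}) ⋯ K(τ_2, τ_1)`. -/
def orderedIntegral (K : ℝ → ℝ → ℂ) (k : ℕ) (t : ℝ) : ℂ :=
  ∫ τ in timeSimplex (2 * k) t, kernelProduct K k τ

/-- `I_0 = 1`. -/
theorem orderedIntegral_zero (K : ℝ → ℝ → ℂ) (t : ℝ) : orderedIntegral K 0 t = 1 := by
  have h : timeSimplex (2 * 0) t = Set.univ := by
    ext τ
    simp only [timeSimplex, Set.mem_ofPred_eq, Set.mem_univ, iff_true]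
    exact ⟨fun i => i.elim0, fun i => i.elim0⟩
  have hp : kernelProduct K 0 = fun _ => 1 := by
    ext τ
    simp [kernelProduct]
  unfold orderedIntegral
  rw [h, hp, MeasureTheory.setIntegral_univ, MeasureTheory.integral_const]
  simp [MeasureTheory.Measure.real, MeasureTheory.volume_pi]

/-- `λ(t) = ∑_k (-1)^k I_k(t)`. -/
def lam (K : ℝ → ℝ → ℂ) (t : ℝ) : ℂ := ∑' k : ℕ, (-1) ^ k * orderedIntegral K k t

end JC

end

end OpenQS

open OpenQS

namespace OpenQS

noncomputable section

universe u

/-! ### Unitary groups and their generators -/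

section UnitaryGroups

variable {H : Type u} [NormedAddCommGroup H] [InnerProductSpace ℂ H]

/-! The Hamiltonian conserves the number of excitations, so the orbit of `φ ⊗ vac` with `φ = a gnd +
b exc` stays in the sector spanned by `gnd ⊗ vac`, `exc ⊗ vac` and `gnd ⊗` (one boson). In the
interaction picture write the state as `gnd ⊗ (a vac + b η_t) + b λ(t) exc ⊗ vac`. The Schrödinger
equation becomes `λ' = -⟨g_t|η_t⟩`, `η' = λ g_t`, with `λ(0) = 1`, `η_0 = 0`. Eliminating `η` gives
the Volterra equation `λ(t) = 1 - ∫₀ᵗ ∫₀ˢ K(s,r) λ(r) dr ds`, whose Neumann series is `∑ (-1)^k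
I_k`. It converges because `|I_k(t)| ≤ (‖g‖t)^{2k}/(2k)!`. Pairing with `e^f` sends `vac` to `1` and
`η_t` to `⟨f|η_t⟩ = ∫₀ᵗ ζ_τ λ(τ) dτ`, which is the formula.

The delicate point is that `g` need not lie in the domain of `h`, while a strong solution must lie
in the domain of the Hamiltonian. The emitted packet `η_t = ∫₀ᵗ λ(r) e^{-iω₀r} V_r g dr` does lie in
that domain, because averaging an orbit against a continuously differentiable weight smooths it
(`UnitaryGroup.integral_mem_domain`). The explicit state `jcState` is then checked to be a solution.
Uniqueness needs only symmetry of the Hamiltonian (`totalHamiltonian_isFormalAdjoint`), since the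
norm of a difference of two solutions is constant; applied to the generator of a unitary group
extending the Hamiltonian, the same argument identifies the group orbit with the solution.

The analytic core is `amplitude_eq` (the series solves the Volterra equation) and
`orderedIntegral_succ` (Fubini turns the simplex integrals into its iterates). -/

theorem hasDerivAt_clm_comp {E E' : Type*} [NormedAddCommGroup E] [NormedSpace ℂ E]
    [NormedAddCommGroup E'] [NormedSpace ℂ E'] (u : E →L[ℂ] E') {f : ℝ → E} {f' : E} {t : ℝ}
    (hf : HasDerivAt f f' t) : HasDerivAt (fun s => u (f s)) (u f') t :=
  (u.restrictScalars ℝ).hasFDerivAt.comp_hasDerivAt t hf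

theorem hasDerivAt_linearIsometry_comp {H' : Type*} [NormedAddCommGroup H']
    [InnerProductSpace ℂ H'] (u : H →ₗᵢ[ℂ] H') {f : ℝ → H} {f' : H} {t : ℝ}
    (hf : HasDerivAt f f' t) : HasDerivAt (fun s => u (f s)) (u f') t :=
  hasDerivAt_clm_comp u.toContinuousLinearMap hf

/-- Product rule for a strongly continuous family of isometries applied to a curve. -/
theorem hasDerivAt_isometry_apply {U : ℝ → H →ₗᵢ[ℂ] H} (hU : ∀ x, Continuous fun t => U t x)
    {f : ℝ → H} {f' d : H} {t : ℝ} (hf : HasDerivAt f f' t)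
    (hd : HasDerivAt (fun s => U s (f t)) d t) :
    HasDerivAt (fun s => U s (f s)) (U t f' + d) t := by
  have h1 : HasDerivAt (fun s => U s (f s - f t)) (U t f') t := by
    rw [hasDerivAt_iff_isLittleO] at hf ⊢
    -- Isometry makes the Taylor remainder of `f` small uniformly in the operator, so strong
    -- continuity of `U` suffices; it enters only through the fixed vector `f'` below.
    have h2 : (fun s => U s (f s - f t - (s - t) • f')) =o[nhds t] fun s => s - t :=
      hf.norm_left.congr_left (fun s => ((U s).norm_map _).symm) |>.of_norm_left
    have h3 : (fun s => (s - t) • (U s f' - U t f')) =o[nhds t] fun s => s - t := by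
      have h4 : (fun s => U s f' - U t f') =o[nhds t] fun _ => (1 : ℝ) := by
        rw [Asymptotics.isLittleO_one_iff]
        have := ((hU f').sub (continuous_const (y := U t f'))).tendsto t
        rwa [Pi.sub_apply, sub_self] at this
      simpa using (Asymptotics.isBigO_refl (fun s : ℝ => s - t) (nhds t)).smul_isLittleO h4
    refine (h2.add h3).congr_left fun s => ?_
    have h5 : U s ((s - t) • f') = (s - t) • U s f' :=
      ((U s).toLinearMap.restrictScalars ℝ).map_smul _ _
    rw [map_sub (U s) (f s - f t), h5, smul_sub, sub_self (f t), map_zero, sub_zero]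
    abel
  refine (h1.add hd).congr_of_eventuallyEq (Filter.Eventually.of_forall fun s => ?_)
  simp

namespace UnitaryGroup

variable (V : UnitaryGroup H)

@[simp]
theorem zero_apply (x : H) : V 0 x = x := by
  rw [V.map_zero']; rfl

theorem add_apply (s t : ℝ) (x : H) : V (s + t) x = V s (V t x) := by
  rw [V.map_add']; rfl

theorem apply_neg_apply (t : ℝ) (x : H) : V t (V (-t) x) = x := by
  rw [← V.add_apply, add_neg_cancel, V.zero_apply]

theorem inner_neg_apply (t : ℝ) (x y : H) : inner ℂ x (V (-t) y) = inner ℂ (V t x) y := by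
  rw [← (V t).inner_map_map, V.apply_neg_apply]

theorem hasDerivAt_zero (x : V.generator.domain) :
    HasDerivAt (fun t => V t (x : H)) (Complex.I • V.generator x) 0 := by
  have h : DifferentiableAt ℝ (fun t => V t (x : H)) 0 := x.2
  have h' : V.generator x = (-Complex.I) • deriv (fun t => V t (x : H)) 0 := rfl
  rw [h', smul_smul]
  simpa using h.hasDerivAt

/-- A single derivative at `0` yields both domain membership and the value of the generator; the
actions of the generator and of `dGamma` below are computed this way. -/
theorem exists_generator_eq {x y : H} (h : HasDerivAt (fun t => V t x) (Complex.I • y) 0) :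
    ∃ hx : x ∈ V.generator.domain, V.generator ⟨x, hx⟩ = y := by
  refine ⟨h.differentiableAt, ?_⟩
  change (-Complex.I) • deriv (fun t => V t x) 0 = y
  rw [h.deriv, smul_smul]
  simp

theorem hasDerivAt_apply (x : V.generator.domain) (t : ℝ) :
    HasDerivAt (fun s => V s (x : H)) (V t (Complex.I • V.generator x)) t := by
  have h1 := hasDerivAt_linearIsometry_comp (V t) (V.hasDerivAt_zero x)
  rw [← sub_self t] at h1
  refine (HasDerivAt.comp_sub_const t t h1).congr_of_eventuallyEq (Filter.Eventually.of_forall fun s => ?_)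
  beta_reduce
  rw [← V.add_apply, add_sub_cancel]

theorem exists_generator_apply (x : V.generator.domain) (t : ℝ) :
    ∃ hx : V t (x : H) ∈ V.generator.domain, V.generator ⟨_, hx⟩ = V t (V.generator x) := by
  apply V.exists_generator_eq
  have h1 := hasDerivAt_linearIsometry_comp (V t) (V.hasDerivAt_zero x)
  rw [map_smul] at h1
  refine h1.congr_of_eventuallyEq (Filter.Eventually.of_forall fun s => ?_)
  simp only [← V.add_apply, add_comm]

theorem hasDerivAt_neg_apply (x : V.generator.domain) (t : ℝ) :
    HasDerivAt (fun s => V (-s) (x : H)) (-(Complex.I • V (-t) (V.generator x))) t := by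
  have h := (V.hasDerivAt_apply x (-t)).scomp t (hasDerivAt_neg t)
  rw [map_smul, neg_smul, one_smul] at h
  exact h

/-- The generator of a unitary group is a symmetric operator. -/
theorem inner_generator_left (x y : V.generator.domain) :
    inner ℂ (V.generator x) (y : H) = inner ℂ (x : H) (V.generator y) := by
  have h := (V.hasDerivAt_zero x).inner ℂ (V.hasDerivAt_zero y)
  have h1 : (fun t => inner ℂ (V t (x : H)) (V t (y : H))) = fun _ => inner ℂ (x : H) (y : H) := by
    ext t; exact (V t).inner_map_map _ _
  rw [h1] at h
  have h2 := h.unique (hasDerivAt_const _ _)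
  simp only [zero_apply, inner_smul_right, inner_smul_left, Complex.conj_I] at h2
  have h3 : Complex.I * (inner ℂ (x : H) (V.generator y) - inner ℂ (V.generator x) (y : H)) = 0 := by
    rw [← h2]; ring
  exact (sub_eq_zero.1 ((mul_eq_zero.1 h3).resolve_left Complex.I_ne_zero)).symm

theorem isSchrodingerSolution (x : V.generator.domain) :
    IsSchrodingerSolution V.generator (x : H) fun t => V (-t) (x : H) := by
  refine ⟨by simp, fun t _ => ?_⟩
  obtain ⟨hx, h⟩ := V.exists_generator_apply x (-t)
  refine ⟨hx, ?_⟩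
  rw [h, neg_smul]
  exact (V.hasDerivAt_neg_apply x t).hasDerivWithinAt

end UnitaryGroup

theorem IsSchrodingerSolution.mono {A B : H →ₗ.[ℂ] H} (hAB : A ≤ B) {x : H} {Φ : ℝ → H}
    (hΦ : IsSchrodingerSolution A x Φ) : IsSchrodingerSolution B x Φ := by
  refine ⟨hΦ.1, fun t ht => ?_⟩
  obtain ⟨hx, h⟩ := hΦ.2 t ht
  refine ⟨hAB.1 hx, ?_⟩
  rwa [hAB.2 (x := ⟨Φ t, hx⟩) (y := ⟨Φ t, hAB.1 hx⟩) rfl] at h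

/-- Solutions of the Schrödinger equation of a symmetric operator are unique. -/
theorem IsSchrodingerSolution.eqOn {A : H →ₗ.[ℂ] H} (hA : A.IsFormalAdjoint A) {x : H}
    {Φ Ψ : ℝ → H} (hΦ : IsSchrodingerSolution A x Φ) (hΨ : IsSchrodingerSolution A x Ψ) :
    ∀ t, 0 ≤ t → Φ t = Ψ t := by
  -- The squared norm of the difference has derivative `2 Re ⟨D, -i A D⟩`, which vanishes because
  -- `⟨D, A D⟩` is real for symmetric `A`.
  have hd : ∀ t, 0 ≤ t →
      HasDerivWithinAt (fun s => inner ℂ (Φ s - Ψ s) (Φ s - Ψ s)) 0 (Set.Ici 0) t := by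
    intro t ht
    obtain ⟨h1, h1'⟩ := hΦ.2 t ht
    obtain ⟨h2, h2'⟩ := hΨ.2 t ht
    have h3 := h1'.sub h2'
    rw [← smul_sub, ← LinearPMap.map_sub] at h3
    have h4 := h3.inner ℂ h3
    have h5 := hA (⟨Φ t, h1⟩ - ⟨Ψ t, h2⟩) (⟨Φ t, h1⟩ - ⟨Ψ t, h2⟩)
    have h6 : inner ℂ ((Φ - Ψ) t) (-Complex.I • A (⟨Φ t, h1⟩ - ⟨Ψ t, h2⟩))
        + inner ℂ (-Complex.I • A (⟨Φ t, h1⟩ - ⟨Ψ t, h2⟩)) ((Φ - Ψ) t) = 0 := by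
      simp only [AddSubgroupClass.coe_sub] at h5
      simp only [Pi.sub_apply, inner_smul_right, inner_smul_left, map_neg, Complex.conj_I, h5]
      ring
    rw [h6] at h4
    exact h4
  intro t ht
  have hc := constant_of_has_deriv_right_zero (a := 0) (b := t)
    (f := fun s => inner ℂ (Φ s - Ψ s) (Φ s - Ψ s))
    (fun s hs => ((hd s hs.1).continuousWithinAt).mono Set.Icc_subset_Ici_self)
    (fun s hs => (hd s hs.1).mono (Set.Ici_subset_Ici.2 hs.1)) t ⟨ht, le_rfl⟩
  simp only [hΦ.1, hΨ.1, sub_self, inner_zero_left] at hc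
  exact sub_eq_zero.1 (inner_self_eq_zero.1 hc)

theorem UnitaryGroup.generator_isFormalAdjoint (V : UnitaryGroup H) :
    V.generator.IsFormalAdjoint V.generator :=
  fun x y => V.inner_generator_left x y

/-- `∫_0^t μ(r) V(r) x dr` is in the domain of the generator of `V` if `μ` is continuously
differentiable. -/
theorem UnitaryGroup.integral_mem_domain [CompleteSpace H] (V : UnitaryGroup H) (x : H)
    {μ μ' : ℝ → ℂ} (hμ : ∀ t, HasDerivAt μ (μ' t) t) (hμ' : Continuous μ') (t : ℝ) :
    (∫ r in (0 : ℝ)..t, μ r • V r x) ∈ V.generator.domain := by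
  have hμc : Continuous μ := continuous_iff_continuousAt.2 fun t => (hμ t).continuousAt
  have hVc := V.continuous' x
  -- The primitive `q` of the orbit is differentiable, and `V s` acts on it by translation: `V s (q
  -- t) = q (t + s) - q s`. Integrating by parts moves the derivative onto `μ` and leaves only
  -- values of `q`, so `s ↦ V s` of the integral is differentiable even when the orbit of `x` is
  -- not.
  set q : ℝ → H := fun t => ∫ r in (0 : ℝ)..t, V r x with hq
  have hqd : ∀ t, HasDerivAt q (V t x) t := fun t =>
    intervalIntegral.integral_hasDerivAt_right (hVc.intervalIntegrable _ _)
      (hVc.stronglyMeasurableAtFilter _ _) hVc.continuousAt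
  have hqc : Continuous q := continuous_iff_continuousAt.2 fun t => (hqd t).continuousAt
  have hVq : ∀ s t, V s (q t) = q (t + s) - q s := by
    intro s t
    have h1 : V s (q t) = ∫ r in (0 : ℝ)..t, V s (V r x) :=
      ((V s).toContinuousLinearMap.intervalIntegral_comp_comm
        (hVc.intervalIntegrable _ _)).symm
    rw [h1]
    simp only [← V.add_apply, add_comm s]
    rw [intervalIntegral.integral_comp_add_right (fun r => V r x) s, zero_add]
    exact (intervalIntegral.integral_interval_sub_left (hVc.intervalIntegrable _ _)
      (hVc.intervalIntegrable _ _)).symm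
  have hparts : (∫ r in (0 : ℝ)..t, μ r • V r x)
      = μ t • q t - ∫ r in (0 : ℝ)..t, μ' r • q r := by
    rw [intervalIntegral.integral_smul_deriv_eq_deriv_smul (fun r _ => hμ r) (fun r _ => hqd r)
      (hμ'.intervalIntegrable _ _) (hVc.intervalIntegrable _ _)]
    simp [hq]
  have hVp : ∀ s, V s (∫ r in (0 : ℝ)..t, μ r • V r x)
      = μ t • (q (t + s) - q s) - ∫ r in (0 : ℝ)..t, μ' r • (q (r + s) - q s) := by
    intro s
    have h1 : V s (∫ r in (0 : ℝ)..t, μ' r • q r) = ∫ r in (0 : ℝ)..t, V s (μ' r • q r) :=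
      ((V s).toContinuousLinearMap.intervalIntegral_comp_comm
        ((hμ'.smul hqc).intervalIntegrable _ _)).symm
    rw [hparts, map_sub, h1]
    simp only [map_smul, hVq]
  have hqs : ∀ r s, HasDerivAt (fun s => q (r + s) - q s) (V (r + s) x - V s x) s := by
    intro r s
    exact (HasDerivAt.comp_const_add r s (hqd (r + s))).sub (hqd s)
  have hqsc : ∀ s, Continuous fun r => μ' r • (q (r + s) - q s) := fun s =>
    hμ'.smul ((hqc.comp (continuous_id.add continuous_const)).sub continuous_const)
  have hint : HasDerivAt (fun s => ∫ r in (0 : ℝ)..t, μ' r • (q (r + s) - q s))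
      (∫ r in (0 : ℝ)..t, μ' r • (V (r + 0) x - V 0 x)) 0 := by
    -- The dominating function comes from `‖V (r + s) x‖ = ‖V s x‖ = ‖x‖`, uniformly in `s`.
    refine (intervalIntegral.hasDerivAt_integral_of_dominated_loc_of_deriv_le
      (bound := fun r => ‖μ' r‖ * (‖x‖ + ‖x‖)) (s := Set.univ)
      (F := fun s r => μ' r • (q (r + s) - q s))
      (F' := fun s r => μ' r • (V (r + s) x - V s x)) Filter.univ_mem
      (Filter.Eventually.of_forall fun s => (hqsc s).aestronglyMeasurable)
      ((hqsc 0).intervalIntegrable _ _) ?_ ?_ ?_ ?_).2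
    · exact (hμ'.smul ((hVc.comp (continuous_id.add continuous_const)).sub
        continuous_const)).aestronglyMeasurable
    · refine Filter.Eventually.of_forall fun r _ s _ => ?_
      rw [norm_smul]
      gcongr
      refine (norm_sub_le _ _).trans ?_
      simp
    · exact (hμ'.norm.mul continuous_const).intervalIntegrable _ _
    · exact Filter.Eventually.of_forall fun r _ s _ => (hqs r s).const_smul _
  have := ((hqs t 0).const_smul (μ t)).sub hint
  change DifferentiableAt ℝ _ 0
  refine (this.congr_of_eventuallyEq (Filter.Eventually.of_forall hVp)).differentiableAt

end UnitaryGroups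

/-! ### The vacuum and the one-particle sector -/

section FockSectors

variable {F : Type u} [NormedAddCommGroup F] [InnerProductSpace ℂ F]

variable (F) in
/-- The inclusion of the one-particle space into Fock space. -/
def oneParticle : F →ₗᵢ[ℂ] Fock F where
  toFun v := lp.single 2 1 (symPow v 1)
  map_add' v w := by
    have h : symPow (v + w) 1 = symPow v 1 + symPow w 1 := by
      apply Subtype.ext
      change (((v + w) ⊗ₜ[ℂ] powVec (0 : F) 0 : F ⊗[ℂ] TPow F 0) :
        UniformSpace.Completion (F ⊗[ℂ] TPow F 0)) = _
      rw [TensorProduct.add_tmul, UniformSpace.Completion.coe_add]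
      rfl
    rw [h, lp.single_add]
  map_smul' c v := by
    have h : symPow (c • v) 1 = c • symPow v 1 := by
      apply Subtype.ext
      change (((c • v) ⊗ₜ[ℂ] powVec (0 : F) 0 : F ⊗[ℂ] TPow F 0) :
        UniformSpace.Completion (F ⊗[ℂ] TPow F 0)) = _
      rw [← TensorProduct.smul_tmul', UniformSpace.Completion.coe_smul]
      rfl
    rw [h, lp.single_smul]
    rfl
  norm_map' v := by
    change ‖lp.single (E := NParticle F) 2 1 (symPow v 1)‖ = ‖v‖
    rw [lp.norm_single (by simp), norm_symPow, pow_one]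

theorem oneParticle_apply (v : F) : oneParticle F v = lp.single 2 1 (symPow v 1) := rfl

theorem inner_expVec_vac (f : F) : inner ℂ (expVec f) (vac F) = 1 := by
  rw [vac, lp.inner_single_right]
  change inner ℂ (((Real.sqrt (Nat.factorial 0))⁻¹ : ℂ) • symPow f 0) _ = _
  rw [inner_smul_left, inner_symPow]
  simp

theorem inner_expVec_oneParticle (f v : F) :
    inner ℂ (expVec f) (oneParticle F v) = inner ℂ f v := by
  rw [oneParticle_apply, lp.inner_single_right]
  change inner ℂ (((Real.sqrt (Nat.factorial 1))⁻¹ : ℂ) • symPow f 1) _ = _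
  rw [inner_smul_left, inner_symPow]
  simp

theorem secondQuantization_single (u : F →ₗᵢ[ℂ] F) (n : ℕ) (x : NParticle F n) :
    secondQuantization u (lp.single 2 n x) = lp.single 2 n (symMap u n x) := by
  ext m : 2
  rw [secondQuantization_apply]
  by_cases h : m = n
  · subst h
    rw [lp.single_apply_self, lp.single_apply_self]
  · rw [lp.single_apply_ne _ _ _ h, lp.single_apply_ne _ _ _ h, map_zero]

theorem fock_vac (V : UnitaryGroup F) (t : ℝ) : V.fock t (vac F) = vac F := by
  change secondQuantization (V t) (lp.single 2 0 (symPow 0 0)) = _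
  rw [secondQuantization_single, symMap_symPow]
  rfl

theorem fock_oneParticle (V : UnitaryGroup F) (t : ℝ) (v : F) :
    V.fock t (oneParticle F v) = oneParticle F (V t v) := by
  change secondQuantization (V t) (lp.single 2 1 (symPow v 1)) = _
  rw [secondQuantization_single, symMap_symPow]
  rfl

theorem dGamma_vac (V : UnitaryGroup F) :
    ∃ hx : vac F ∈ (dGamma V).domain, dGamma V ⟨vac F, hx⟩ = 0 := by
  apply V.fock.exists_generator_eq
  simp only [fock_vac, smul_zero]
  exact hasDerivAt_const _ _

theorem dGamma_oneParticle (V : UnitaryGroup F) (v : V.generator.domain) :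
    ∃ hx : oneParticle F v ∈ (dGamma V).domain,
      dGamma V ⟨_, hx⟩ = oneParticle F (V.generator v) := by
  apply V.fock.exists_generator_eq
  simp only [fock_oneParticle]
  rw [← map_smul]
  exact hasDerivAt_linearIsometry_comp (oneParticle F) (V.hasDerivAt_zero v)

theorem annihilation_single_zero (g : F) (x : NParticle F 0) :
    ∃ hx : lp.single 2 0 x ∈ (annihilation g).domain, annihilation g ⟨_, hx⟩ = 0 := by
  have h : (fun n : ℕ => ((Real.sqrt (n + 1) : ℝ) : ℂ) • symContract g n
      ((lp.single 2 0 x : Fock F) (n + 1))) = fun n => (0 : NParticle F n) := by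
    ext1 n
    rw [lp.single_apply_ne _ _ _ (Nat.succ_ne_zero n), map_zero, smul_zero]
  refine ⟨?_, ?_⟩
  · change Memℓp _ 2
    rw [h]
    exact zero_memℓp
  · exact lp.ext h

theorem annihilation_single_succ (g : F) (n : ℕ) (x : NParticle F (n + 1)) :
    ∃ hx : lp.single 2 (n + 1) x ∈ (annihilation g).domain,
      annihilation g ⟨_, hx⟩
        = lp.single 2 n (((Real.sqrt (n + 1) : ℝ) : ℂ) • symContract g n x) := by
  have h : (fun m : ℕ => ((Real.sqrt (m + 1) : ℝ) : ℂ) • symContract g m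
      ((lp.single 2 (n + 1) x : Fock F) (m + 1)))
      = ⇑(lp.single 2 n (((Real.sqrt (n + 1) : ℝ) : ℂ) • symContract g n x) : Fock F) := by
    ext1 m
    by_cases hm : m = n
    · subst hm
      rw [lp.single_apply_self, lp.single_apply_self]
    · rw [lp.single_apply_ne _ _ _ hm, lp.single_apply_ne _ _ _ (by simpa using hm), map_zero,
        smul_zero]
  refine ⟨?_, ?_⟩
  · change Memℓp _ 2
    rw [h]
    exact lp.memℓp _
  · exact lp.ext h

theorem annihilation_vac (g : F) :
    ∃ hx : vac F ∈ (annihilation g).domain, annihilation g ⟨vac F, hx⟩ = 0 :=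
  annihilation_single_zero g _

theorem annihilation_oneParticle (g v : F) :
    ∃ hx : oneParticle F v ∈ (annihilation g).domain,
      annihilation g ⟨_, hx⟩ = inner ℂ g v • vac F := by
  obtain ⟨hx, h⟩ := annihilation_single_succ g 0 (symPow v 1)
  refine ⟨hx, h.trans ?_⟩
  rw [symContract_symPow, vac, ← lp.single_smul]
  simp
  rfl

/-- Finite-particle vectors lie in the domain and are dense. Density is what gives `creation`,
defined as an adjoint, its meaning: `LinearPMap.adjoint` takes the value zero otherwise. -/
theorem dense_annihilation_domain (g : F) : Dense ((annihilation g).domain : Set (Fock F)) := by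
  have hsingle : ∀ n (x : NParticle F n), lp.single 2 n x ∈ (annihilation g).domain := by
    rintro (_ | n) x
    · exact (annihilation_single_zero g x).1
    · exact (annihilation_single_succ g n x).1
  intro Ψ
  refine mem_closure_of_tendsto (lp.hasSum_single (by simp) Ψ)
    (Filter.Eventually.of_forall fun s => Submodule.sum_mem _ fun i _ => hsingle i _)

/-- Against a vector supported in degree `n`, only the degree `n + 1` component of `Ψ` contributes
to `⟨x, a(g) Ψ⟩`. The adjoint is therefore that of one bounded contraction, and no explicit
symmetrization is needed. -/
theorem creation_single (g : F) (n : ℕ) (x : NParticle F n) :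
    ∃ hx : lp.single 2 n x ∈ (creation g).domain,
      creation g ⟨_, hx⟩ = lp.single 2 (n + 1)
        (((Real.sqrt (n + 1) : ℝ) : ℂ) • ContinuousLinearMap.adjoint (symContract g n) x) := by
  have h : ∀ Ψ : (annihilation g).domain,
      inner ℂ (lp.single 2 (n + 1)
        (((Real.sqrt (n + 1) : ℝ) : ℂ) • ContinuousLinearMap.adjoint (symContract g n) x) : Fock F)
        (Ψ : Fock F) = inner ℂ (lp.single 2 n x : Fock F) (annihilation g Ψ) := by
    intro Ψ
    rw [lp.inner_single_left, lp.inner_single_left, inner_smul_left,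
      ContinuousLinearMap.adjoint_inner_left, Complex.conj_ofReal]
    exact (inner_smul_right _ _ _).symm
  have hx := LinearPMap.mem_adjoint_domain_of_exists (T := annihilation g) (lp.single 2 n x) ⟨_, h⟩
  exact ⟨hx, LinearPMap.adjoint_apply_eq (dense_annihilation_domain g) ⟨_, hx⟩ h⟩

theorem creation_vac (g : F) :
    ∃ hx : vac F ∈ (creation g).domain, creation g ⟨vac F, hx⟩ = oneParticle F g := by
  obtain ⟨hx, h⟩ := creation_single g 0 (symPow 0 0)
  refine ⟨hx, h.trans ?_⟩
  -- Both sides define continuous functionals on the one-boson space, so it suffices to compare them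
  -- on the vectors `symPow f 1`.
  have h1 : ContinuousLinearMap.adjoint (symContract g 0) (symPow 0 0) = symPow g 1 := by
    refine ext_inner_right ℂ fun y => ?_
    rw [ContinuousLinearMap.adjoint_inner_left]
    refine mem_of_symPow_mem (LinearMap.eqLocus
      ((innerSL ℂ (symPow (0 : F) 0)).comp (symContract g 0)).toLinearMap
      (innerSL ℂ (symPow g 1)).toLinearMap) ?_ (fun f => ?_) y
    · exact isClosed_eq ((innerSL ℂ (symPow (0 : F) 0)).comp (symContract g 0)).continuous
        (innerSL ℂ (symPow g 1)).continuous
    · change inner ℂ (symPow (0 : F) 0) (symContract g 0 (symPow f 1))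
        = inner ℂ (symPow g 1) (symPow f 1)
      rw [symContract_symPow, inner_smul_right, inner_symPow, inner_symPow]
      simp
  rw [h1, oneParticle_apply]
  simp

theorem annihilation_isFormalAdjoint_creation (g : F) :
    (annihilation g).IsFormalAdjoint (creation g) :=
  (LinearPMap.adjoint_isFormalAdjoint (dense_annihilation_domain g)).symm

end FockSectors

/-! ### Operators on the coupled system -/

section Tensor

variable {S H : Type*} [NormedAddCommGroup S] [InnerProductSpace ℂ S]
  [NormedAddCommGroup H] [InnerProductSpace ℂ H]

/-- States of the two-level atom and the bath are handled as one tensor for the ground state plus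
one for the excited state; this evaluates an unbounded tensor operator on that form. -/
theorem exists_tensorPMap_tmul_add_tmul (X : S →L[ℂ] S) (A : H →ₗ.[ℂ] H) (s s' : S) {x x' y y' : H}
    (hx : ∃ h : x ∈ A.domain, A ⟨x, h⟩ = y) (hx' : ∃ h : x' ∈ A.domain, A ⟨x', h⟩ = y') :
    ∃ h : s ⊗ₜ[ℂ] x + s' ⊗ₜ[ℂ] x' ∈ (tensorPMap X A).domain,
      tensorPMap X A ⟨_, h⟩ = X s ⊗ₜ[ℂ] y + X s' ⊗ₜ[ℂ] y' := by
  obtain ⟨hx, rfl⟩ := hx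
  obtain ⟨hx', rfl⟩ := hx'
  have h1 : s ⊗ₜ[ℂ] x ∈ (tensorPMap X A).domain := ⟨s ⊗ₜ ⟨x, hx⟩, by simp⟩
  have h2 : s' ⊗ₜ[ℂ] x' ∈ (tensorPMap X A).domain := ⟨s' ⊗ₜ ⟨x', hx'⟩, by simp⟩
  refine ⟨add_mem h1 h2, ?_⟩
  rw [← tensorPMap_tmul X A s ⟨x, hx⟩ h1, ← tensorPMap_tmul X A s' ⟨x', hx'⟩ h2,
    ← LinearPMap.map_add]
  rfl

theorem tensorPMap_isFormalAdjoint [CompleteSpace S] (X : S →L[ℂ] S) {A B : H →ₗ.[ℂ] H}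
    (h : A.IsFormalAdjoint B) :
    (tensorPMap X A).IsFormalAdjoint (tensorPMap (ContinuousLinearMap.adjoint X) B) := by
  have key : ∀ (p : S ⊗[ℂ] A.domain) (q : S ⊗[ℂ] B.domain),
      inner ℂ (TensorProduct.map (X : S →ₗ[ℂ] S) A.toFun p) (B.domain.subtype.lTensor S q)
        = inner ℂ (A.domain.subtype.lTensor S p)
          (TensorProduct.map (ContinuousLinearMap.adjoint X : S →ₗ[ℂ] S) B.toFun q) := by
    intro p q
    induction p using TensorProduct.induction_on with
    | zero => simp
    | add p p' hp hp' => simp only [map_add, inner_add_left, hp, hp']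
    | tmul s x =>
      induction q using TensorProduct.induction_on with
      | zero => simp
      | add q q' hq hq' => simp only [map_add, inner_add_right, hq, hq']
      | tmul s' y =>
        simp only [TensorProduct.map_tmul, LinearMap.lTensor_tmul, TensorProduct.inner_tmul,
          Submodule.subtype_apply, ContinuousLinearMap.coe_coe,
          ContinuousLinearMap.adjoint_inner_right]
        exact congrArg _ (h x y)
  -- A vector in the domain is the image of a unique tensor over `A.domain`, on which the operator
  -- is the algebraic `X ⊗ A`; this reduces the claim to `key`.
  have hval : ∀ (X : S →L[ℂ] S) (A : H →ₗ.[ℂ] H) (x : (tensorPMap X A).domain),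
      ∃ p : S ⊗[ℂ] A.domain, A.domain.subtype.lTensor S p = x ∧
        tensorPMap X A x = TensorProduct.map (X : S →ₗ[ℂ] S) A.toFun p := by
    intro X A x
    refine ⟨(LinearEquiv.ofInjective (A.domain.subtype.lTensor S)
      (Module.Flat.lTensor_preserves_injective_linearMap A.domain.subtype
        A.domain.injective_subtype)).symm x, ?_, rfl⟩
    exact congrArg Subtype.val (LinearEquiv.apply_symm_apply (LinearEquiv.ofInjective
      (A.domain.subtype.lTensor S) (Module.Flat.lTensor_preserves_injective_linearMap
        A.domain.subtype A.domain.injective_subtype)) x)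
  intro x y
  obtain ⟨p, hp, hp'⟩ := hval _ _ x
  obtain ⟨q, hq, hq'⟩ := hval _ _ y
  rw [hp', hq', ← hp, ← hq]
  exact key p q

end Tensor

/-! ### The Hamiltonian: symmetry and action on the one-excitation sector -/

section Model

variable {S : Type*} [NormedAddCommGroup S] [InnerProductSpace ℂ S] [CompleteSpace S]
variable {F : Type u} [NormedAddCommGroup F] [InnerProductSpace ℂ F]

/-- The total Hamiltonian is symmetric. -/
theorem totalHamiltonian_isFormalAdjoint {H : S →L[ℂ] S} (hH : IsSelfAdjoint H) (L : S →L[ℂ] S)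
    (V : UnitaryGroup F) (g : F) :
    (totalHamiltonian H L V g).IsFormalAdjoint (totalHamiltonian H L V g) := by
  have hid : (LinearMap.toPMap (LinearMap.id : Fock F →ₗ[ℂ] Fock F) ⊤).IsFormalAdjoint
      (LinearMap.toPMap (LinearMap.id : Fock F →ₗ[ℂ] Fock F) ⊤) := fun _ _ => rfl
  have h1 := tensorPMap_isFormalAdjoint H hid
  rw [ContinuousLinearMap.isSelfAdjoint_iff'.1 hH] at h1
  have h2 := tensorPMap_isFormalAdjoint (ContinuousLinearMap.id ℂ S)
    V.fock.generator_isFormalAdjoint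
  rw [ContinuousLinearMap.adjoint_id] at h2
  have h3 := tensorPMap_isFormalAdjoint L (annihilation_isFormalAdjoint_creation g).symm
  have h4 := tensorPMap_isFormalAdjoint (ContinuousLinearMap.adjoint L)
    (annihilation_isFormalAdjoint_creation g)
  rw [ContinuousLinearMap.adjoint_adjoint] at h4
  rintro ⟨x, ⟨⟨hx1, hx2⟩, hx3⟩, hx4⟩ ⟨y, ⟨⟨hy1, hy2⟩, hy3⟩, hy4⟩
  -- The two coupling terms are formal adjoints of each other: `(i L ⊗ a*)` pairs with `(-i L* ⊗
  -- a)`. Hence the crossed indices `q₄`, `q₃`.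
  have key : ∀ {E : Type _} [NormedAddCommGroup E] [InnerProductSpace ℂ E]
      (x y p₁ p₂ p₃ p₄ q₁ q₂ q₃ q₄ : E), inner ℂ p₁ y = inner ℂ x q₁ →
      inner ℂ p₂ y = inner ℂ x q₂ → inner ℂ p₃ y = inner ℂ x q₄ → inner ℂ p₄ y = inner ℂ x q₃ →
      inner ℂ (p₁ + p₂ + Complex.I • p₃ - Complex.I • p₄) y
        = inner ℂ x (q₁ + q₂ + Complex.I • q₃ - Complex.I • q₄) := by
    intro E _ _ x y p₁ p₂ p₃ p₄ q₁ q₂ q₃ q₄ e₁ e₂ e₃ e₄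
    simp only [inner_add_left, inner_sub_left, inner_add_right, inner_sub_right, inner_smul_left,
      inner_smul_right, Complex.conj_I, e₁, e₂, e₃, e₄]
    ring
  exact key x y _ _ _ _ _ _ _ _ (h1 ⟨x, hx1⟩ ⟨y, hy1⟩) (h2 ⟨x, hx2⟩ ⟨y, hy2⟩)
    (h3 ⟨x, hx3⟩ ⟨y, hy4⟩) (h4 ⟨x, hx4⟩ ⟨y, hy3⟩)

theorem isSelfAdjoint_smul_rankOne (ω : ℝ) (x : S) :
    IsSelfAdjoint ((ω : ℂ) • InnerProductSpace.rankOne ℂ x x) := by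
  rw [ContinuousLinearMap.isSelfAdjoint_iff', map_smulₛₗ, InnerProductSpace.adjoint_rankOne,
    starRingEnd_apply, Complex.star_def, Complex.conj_ofReal]

/-- The Jaynes–Cummings Hamiltonian on states with at most one excitation. -/
theorem jcHamiltonian_apply {gnd exc : S} (hortho : Orthonormal ℂ ![gnd, exc]) (ω₀ : ℝ)
    (V : UnitaryGroup F) (g : F) (a c : ℂ) (v : V.generator.domain) :
    ∃ h : gnd ⊗ₜ[ℂ] (a • vac F + oneParticle F v) + exc ⊗ₜ[ℂ] (c • vac F)
        ∈ (jcHamiltonian gnd exc ω₀ V g).domain,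
      jcHamiltonian gnd exc ω₀ V g ⟨_, h⟩
        = gnd ⊗ₜ[ℂ] oneParticle F (V.generator v + (Complex.I * c) • g)
          + exc ⊗ₜ[ℂ] ((ω₀ * c - Complex.I * inner ℂ g (v : F)) • vac F) := by
  have hlin : ∀ (A : Fock F →ₗ.[ℂ] Fock F) {x y x' y' : Fock F} (b : ℂ),
      (∃ h : x ∈ A.domain, A ⟨x, h⟩ = x') → (∃ h : y ∈ A.domain, A ⟨y, h⟩ = y') →
      ∃ h : b • x + y ∈ A.domain, A ⟨_, h⟩ = b • x' + y' := by
    rintro A x y _ _ b ⟨hx, rfl⟩ ⟨hy, rfl⟩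
    refine ⟨add_mem (A.domain.smul_mem b hx) hy, ?_⟩
    rw [← LinearPMap.map_smul, ← LinearPMap.map_add]
    rfl
  have hzero : ∀ A : Fock F →ₗ.[ℂ] Fock F, ∃ h : (0 : Fock F) ∈ A.domain, A ⟨0, h⟩ = 0 :=
    fun A => ⟨A.domain.zero_mem, A.map_zero⟩
  have hsmul : ∀ (A : Fock F →ₗ.[ℂ] Fock F) {x x' : Fock F} (b : ℂ),
      (∃ h : x ∈ A.domain, A ⟨x, h⟩ = x') → ∃ h : b • x ∈ A.domain, A ⟨_, h⟩ = b • x' := by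
    intro A x x' b hx
    simpa only [add_zero] using hlin A b hx (hzero A)
  obtain ⟨h1, e1⟩ := exists_tensorPMap_tmul_add_tmul
    ((ω₀ : ℂ) • InnerProductSpace.rankOne ℂ exc exc)
    (LinearMap.toPMap (LinearMap.id : Fock F →ₗ[ℂ] Fock F) ⊤) gnd exc
    (y := a • vac F + oneParticle F v) (y' := c • vac F) ⟨Submodule.mem_top, rfl⟩
    ⟨Submodule.mem_top, rfl⟩
  obtain ⟨h2, e2⟩ := exists_tensorPMap_tmul_add_tmul (ContinuousLinearMap.id ℂ S) (dGamma V)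
    gnd exc (hlin _ a (dGamma_vac V) (dGamma_oneParticle V v)) (hsmul _ c (dGamma_vac V))
  -- Creation on the one-boson vector yields a two-boson term, but it sits beside `L gnd = 0`; only
  -- its existence matters, so its value is left unevaluated.
  obtain ⟨h3, e3⟩ := exists_tensorPMap_tmul_add_tmul (InnerProductSpace.rankOne ℂ gnd exc)
    (creation g) gnd exc (hlin _ a (creation_vac g) (creation_single g 1 (symPow (v : F) 1)))
    (hsmul _ c (creation_vac g))
  obtain ⟨h4, e4⟩ := exists_tensorPMap_tmul_add_tmul
    (ContinuousLinearMap.adjoint (InnerProductSpace.rankOne ℂ gnd exc))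
    (annihilation g) gnd exc (hlin _ a (annihilation_vac g) (annihilation_oneParticle g v))
    (hsmul _ c (annihilation_vac g))
  have hge : inner ℂ exc gnd = 0 := by simpa using hortho.2 (i := 1) (j := 0) (by simp)
  have heg : inner ℂ gnd exc = 0 := by simpa using hortho.2 (i := 0) (j := 1) (by simp)
  have hgg : inner ℂ gnd gnd = 1 := by
    rw [inner_self_eq_norm_sq_to_K, show ‖gnd‖ = 1 from hortho.1 0]
    simp
  have hee : inner ℂ exc exc = 1 := by
    rw [inner_self_eq_norm_sq_to_K, show ‖exc‖ = 1 from hortho.1 1]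
    simp
  refine ⟨⟨⟨⟨h1, h2⟩, h3⟩, h4⟩, ?_⟩
  refine (congrArg₂ (· - ·) (congrArg₂ (· + ·) (congrArg₂ (· + ·) e1 e2)
    (congrArg (Complex.I • ·) e3)) (congrArg (Complex.I • ·) e4)).trans ?_
  simp only [InnerProductSpace.adjoint_rankOne, InnerProductSpace.rankOne_apply, hge, heg, hgg, hee,
    smul_apply, ContinuousLinearMap.id_apply, zero_smul, one_smul, smul_zero,
    TensorProduct.zero_tmul, zero_add, add_zero,
    TensorProduct.tmul_zero, map_add, map_smul, TensorProduct.tmul_add, TensorProduct.tmul_smul,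
    ← TensorProduct.smul_tmul', sub_smul, TensorProduct.tmul_sub, smul_smul]
  module

end Model

/-! ### Time-ordered integrals -/

section OrderedIntegrals

open MeasureTheory

theorem measurableSet_timeSimplex (n : ℕ) (t : ℝ) : MeasurableSet (timeSimplex n t) := by
  have h : timeSimplex n t = (⋂ (i : Fin n) (j : Fin n) (_ : i < j), {τ | τ i < τ j}) ∩
      ⋂ i, {τ | 0 ≤ τ i ∧ τ i ≤ t} := by
    ext τ
    simp [timeSimplex, StrictMono]
  rw [h]
  refine MeasurableSet.inter ?_ (MeasurableSet.iInter fun i => ?_)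
  · exact MeasurableSet.iInter fun i => MeasurableSet.iInter fun j => MeasurableSet.iInter fun _ =>
      measurableSet_lt (measurable_pi_apply i) (measurable_pi_apply j)
  · exact (measurableSet_le measurable_const (measurable_pi_apply i)).inter
      (measurableSet_le (measurable_pi_apply i) measurable_const)

theorem _root_.Continuous.integrableOn_timeSimplex {E : Type*} [NormedAddCommGroup E] {n : ℕ}
    {f : (Fin n → ℝ) → E} (hf : Continuous f) (t : ℝ) : IntegrableOn f (timeSimplex n t) := by
  refine (hf.integrableOn_Icc (a := fun _ => 0) (b := fun _ => t)).mono_set fun τ hτ => ?_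
  exact ⟨fun i => (hτ.2 i).1, fun i => (hτ.2 i).2⟩

theorem snoc_mem_timeSimplex_iff {n : ℕ} {τ : Fin n → ℝ} {s t : ℝ} :
    (Fin.snoc τ s : Fin (n + 1) → ℝ) ∈ timeSimplex (n + 1) t ↔
      (StrictMono τ ∧ ∀ i, 0 ≤ τ i ∧ τ i < s) ∧ 0 ≤ s ∧ s ≤ t := by
  constructor
  · rintro ⟨h1, h2⟩
    refine ⟨⟨fun i j hij => ?_, fun i => ⟨?_, ?_⟩⟩, ?_⟩
    · simpa using h1 (Fin.castSucc_lt_castSucc_iff.2 hij)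
    · simpa using (h2 i.castSucc).1
    · simpa using h1 (Fin.castSucc_lt_last i)
    · simpa using h2 (Fin.last n)
  · rintro ⟨⟨h1, h2⟩, h3⟩
    refine ⟨fun i j hij => ?_, fun i => ?_⟩
    · induction j using Fin.lastCases with
      | last =>
        induction i using Fin.lastCases with
        | last => exact absurd hij (lt_irrefl _)
        | cast i => simpa using (h2 i).2
      | cast j =>
        induction i using Fin.lastCases with
        | last => exact absurd (hij.trans (Fin.castSucc_lt_last j)) (lt_irrefl _)
        | cast i => simpa using h1 (Fin.castSucc_lt_castSucc_iff.1 hij)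
    · induction i using Fin.lastCases with
      | last => simpa using h3
      | cast i => simpa using ⟨(h2 i).1, (h2 i).2.le.trans h3.2⟩

/-- The slice requires the earlier times to be strictly below `s`, the simplex up to `s` only
weakly; the difference lies in the null hyperplanes `τ i = s`. -/
theorem preimage_snoc_timeSimplex_ae_eq {n : ℕ} {s t : ℝ} (hs : 0 ≤ s) (hst : s ≤ t) :
    {τ : Fin n → ℝ | (Fin.snoc τ s : Fin (n + 1) → ℝ) ∈ timeSimplex (n + 1) t}
      =ᵐ[volume] timeSimplex n s := by
  have hne : ∀ᵐ τ : Fin n → ℝ, ∀ i, τ i ≠ s :=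
    ae_all_iff.2 fun i => Measure.ae_eval_ne (fun _ : Fin n => (volume : Measure ℝ)) i s
  filter_upwards [hne] with τ hτ
  refine propext (snoc_mem_timeSimplex_iff.trans ?_)
  refine ⟨fun h => ⟨h.1.1, fun i => ⟨(h.1.2 i).1, (h.1.2 i).2.le⟩⟩, fun h => ⟨⟨h.1, fun i =>
    ⟨(h.2 i).1, lt_of_le_of_ne (h.2 i).2 (hτ i)⟩⟩, hs, hst⟩⟩

/-- Integration over the simplex, with the latest time integrated last. -/
theorem setIntegral_timeSimplex_succ {n : ℕ} {f : (Fin (n + 1) → ℝ) → ℂ} (hf : Continuous f)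
    {t : ℝ} (ht : 0 ≤ t) :
    ∫ τ in timeSimplex (n + 1) t, f τ
      = ∫ s in (0 : ℝ)..t, ∫ τ in timeSimplex n s, f (Fin.snoc τ s) := by
  -- Splitting off the last coordinate preserves Lebesgue measure, so Fubini applies to the
  -- indicator of the simplex; slices at `s` outside `[0, t]` are empty.
  set e := (MeasurableEquiv.piFinSuccAbove (fun _ : Fin (n + 1) => ℝ) (Fin.last n)).symm
  have hmp : MeasurePreserving e :=
    (volume_preserving_piFinSuccAbove (fun _ : Fin (n + 1) => ℝ) (Fin.last n)).symm _
  have he' : ∀ s τ, e (s, τ) = Fin.snoc τ s := fun s τ => Fin.insertNth_last' s τ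
  have hm := measurableSet_timeSimplex (n + 1) t
  have hm' : MeasurableSet (e ⁻¹' timeSimplex (n + 1) t) := e.measurable hm
  have hint : Integrable ((e ⁻¹' timeSimplex (n + 1) t).indicator fun p => f (e p)) := by
    rw [integrable_indicator_iff hm']
    exact (hmp.integrableOn_comp_preimage e.measurableEmbedding).2 (hf.integrableOn_timeSimplex t)
  rw [← hmp.setIntegral_preimage_emb e.measurableEmbedding, ← integral_indicator hm',
    Measure.volume_eq_prod, integral_prod _ hint, intervalIntegral.integral_of_le ht,
    ← integral_Icc_eq_integral_Ioc, ← integral_indicator measurableSet_Icc]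
  congr 1
  ext s
  by_cases hs : s ∈ Set.Icc 0 t
  · rw [Set.indicator_of_mem hs]
    have hsnoc : Measurable fun τ : Fin n → ℝ => e (s, τ) :=
      e.measurable.comp measurable_prodMk_left
    have h1 : (fun τ => (e ⁻¹' timeSimplex (n + 1) t).indicator (fun p => f (e p)) (s, τ))
        = ({τ : Fin n → ℝ | (Fin.snoc τ s : Fin (n + 1) → ℝ) ∈ timeSimplex (n + 1) t}).indicator
          fun τ => f (Fin.snoc τ s) := by
      ext τ
      have h : (s, τ) ∈ e ⁻¹' timeSimplex (n + 1) t ↔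
          (Fin.snoc τ s : Fin (n + 1) → ℝ) ∈ timeSimplex (n + 1) t := by
        rw [Set.mem_preimage, he']
      by_cases hτ : (Fin.snoc τ s : Fin (n + 1) → ℝ) ∈ timeSimplex (n + 1) t
      · refine (Set.indicator_of_mem (h.2 hτ) _).trans ?_
        rw [he', Set.indicator_of_mem (by exact hτ)]
      · rw [Set.indicator_of_notMem (mt h.1 hτ), Set.indicator_of_notMem (by exact hτ)]
    have h2 : MeasurableSet
        {τ : Fin n → ℝ | (Fin.snoc τ s : Fin (n + 1) → ℝ) ∈ timeSimplex (n + 1) t} := by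
      simp only [← he']
      exact hsnoc hm
    rw [h1, integral_indicator h2]
    exact setIntegral_congr_set (preimage_snoc_timeSimplex_ae_eq hs.1 hs.2)
  · rw [Set.indicator_of_notMem hs]
    refine integral_eq_zero_of_ae (Filter.Eventually.of_forall fun τ => ?_)
    refine Set.indicator_of_notMem (fun h => hs ?_) _
    rw [Set.mem_preimage, he', snoc_mem_timeSimplex_iff] at h
    exact h.2

theorem continuous_kernelProduct {K : ℝ → ℝ → ℂ} (hK : Continuous fun p : ℝ × ℝ => K p.1 p.2)
    (k : ℕ) : Continuous (kernelProduct K k) :=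
  continuous_finsetProd _ fun j _ =>
    hK.comp (f := fun τ : Fin (2 * k) → ℝ => (τ ⟨2 * j + 1, by omega⟩, τ ⟨2 * j, by omega⟩)) ((continuous_apply _).prodMk (continuous_apply _))

theorem kernelProduct_snoc_snoc (K : ℝ → ℝ → ℂ) (k : ℕ) (τ : Fin (2 * k) → ℝ) (r s : ℝ) :
    kernelProduct K (k + 1)
        (Fin.snoc (n := 2 * k + 1) (α := fun _ => ℝ) (Fin.snoc (n := 2 * k) τ r) s)
      = K s r * kernelProduct K k τ := by
  rw [kernelProduct, Fin.prod_univ_castSucc, mul_comm, kernelProduct]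
  congr 1
  · congr 1
    · simp [Fin.snoc]
    · simp [Fin.snoc]
  · refine Finset.prod_congr rfl fun j _ => ?_
    have := j.2
    congr 1
    · simp [Fin.snoc, show 2 * (j : ℕ) + 1 < 2 * k by omega, show 2 * (j : ℕ) + 1 < 2 * k + 1 by omega]
    · simp [Fin.snoc, show 2 * (j : ℕ) < 2 * k + 1 by omega]

/-- The two latest times occur only in the last kernel factor, so integrating them last exhibits the
Picard iteration of the Volterra equation. -/
theorem orderedIntegral_succ {K : ℝ → ℝ → ℂ} (hK : Continuous fun p : ℝ × ℝ => K p.1 p.2)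
    (k : ℕ) {t : ℝ} (ht : 0 ≤ t) :
    orderedIntegral K (k + 1) t
      = ∫ s in (0 : ℝ)..t, ∫ r in (0 : ℝ)..s, K s r * orderedIntegral K k r := by
  have hc := continuous_kernelProduct hK (k + 1)
  refine (setIntegral_timeSimplex_succ (n := 2 * k + 1) hc ht).trans ?_
  refine intervalIntegral.integral_congr fun s hs => ?_
  rw [Set.uIcc_of_le ht] at hs
  have hsn : ∀ {n : ℕ} (s : ℝ), Continuous fun τ : Fin n → ℝ => (Fin.snoc τ s : Fin (n + 1) → ℝ) :=
    fun s => Continuous.finSnoc (A := fun _ => ℝ) continuous_id continuous_const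
  refine (setIntegral_timeSimplex_succ (n := 2 * k)
    (f := fun τ => kernelProduct K (k + 1) (Fin.snoc (n := 2 * k + 1) (α := fun _ => ℝ) τ s))
    (hc.comp (hsn s)) hs.1).trans ?_
  refine intervalIntegral.integral_congr fun r _ => ?_
  simp only [kernelProduct_snoc_snoc]
  exact integral_const_mul _ _

end OrderedIntegrals

/-! ### The survival amplitude -/

section Amplitude

open MeasureTheory

theorem hasDerivAt_integral_of_continuous {E : Type*} [NormedAddCommGroup E] [NormedSpace ℝ E]
    [CompleteSpace E] {f : ℝ → E} (hf : Continuous f) (t : ℝ) :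
    HasDerivAt (fun t => ∫ r in (0 : ℝ)..t, f r) (f t) t :=
  intervalIntegral.integral_hasDerivAt_right (hf.intervalIntegrable _ _)
    (hf.stronglyMeasurableAtFilter _ _) hf.continuousAt

/-- Each time integration raises the power by one and divides by the new exponent, which produces
the factorials; the absolute values cover negative times. -/
theorem norm_integral_le_pow {E : Type*} [NormedAddCommGroup E] [NormedSpace ℝ E] {f : ℝ → E}
    {A : ℝ} {n : ℕ} (hf : Continuous f) (h : ∀ r, ‖f r‖ ≤ A * |r| ^ n) (t : ℝ) :
    ‖∫ r in (0 : ℝ)..t, f r‖ ≤ A * (|t| ^ (n + 1) / (n + 1)) := by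
  refine intervalIntegral.norm_integral_le_integral_norm_uIoc.trans ?_
  have h1 := integral_pow_abs_sub_uIoc (a := 0) (b := t) (n := n)
  simp only [sub_zero] at h1
  rw [← h1, ← integral_const_mul]
  refine setIntegral_mono ?_ ?_ h
  · exact (hf.norm.intervalIntegrable 0 t).def'
  · exact ((continuous_const.mul (continuous_abs.pow n)).intervalIntegrable 0 t).def'

theorem hasSum_integral_of_norm_le {E : Type*} [NormedAddCommGroup E] [NormedSpace ℝ E]
    {f : ℕ → ℝ → E} {F : ℝ → E} {b : ℕ → ℝ} {t : ℝ} (hf : ∀ n, Continuous (f n))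
    (hb : Summable b) (hfb : ∀ n r, |r| ≤ |t| → ‖f n r‖ ≤ b n)
    (hF : ∀ r, HasSum (fun n => f n r) (F r)) :
    HasSum (fun n => ∫ r in (0 : ℝ)..t, f n r) (∫ r in (0 : ℝ)..t, F r) := by
  refine intervalIntegral.hasSum_integral_of_dominated_convergence (fun n _ => b n)
    (fun n => (hf n).aestronglyMeasurable) (fun n => Filter.Eventually.of_forall fun r hr => ?_)
    (Filter.Eventually.of_forall fun _ _ => hb) intervalIntegrable_const
    (Filter.Eventually.of_forall fun r _ => hF r)
  refine hfb n r ?_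
  have h := Set.abs_sub_left_of_mem_uIcc (Set.uIoc_subset_uIcc hr)
  simpa using h

variable {F : Type u} [NormedAddCommGroup F] [InnerProductSpace ℂ F]

/-- The iterated integrals of the kernel `⟨m_t|m_s⟩`, for all real times. -/
def iteratedIntegral (m : ℝ → F) : ℕ → ℝ → ℂ
  | 0 => fun _ => 1
  | k + 1 => fun t => ∫ s in (0 : ℝ)..t,
      inner ℂ (m s) (∫ r in (0 : ℝ)..s, iteratedIntegral m k r • m r)

/-- The alternating sum of the iterated integrals. -/
def amplitude (m : ℝ → F) (t : ℝ) : ℂ := ∑' k : ℕ, (-1) ^ k * iteratedIntegral m k t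

/-- The wave packet emitted up to time `t`. -/
def emitted (m : ℝ → F) (t : ℝ) : F := ∫ r in (0 : ℝ)..t, amplitude m r • m r

variable [CompleteSpace F] {m : ℝ → F}

theorem continuous_iteratedIntegral (hm : Continuous m) (k : ℕ) :
    Continuous (iteratedIntegral m k) := by
  induction k with
  | zero => exact continuous_const
  | succ k ih =>
    have h1 : Continuous fun s => ∫ r in (0 : ℝ)..s, iteratedIntegral m k r • m r :=
      continuous_iff_continuousAt.2 fun t =>
        (hasDerivAt_integral_of_continuous (ih.smul hm) t).continuousAt
    exact continuous_iff_continuousAt.2 fun t =>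
        (hasDerivAt_integral_of_continuous (hm.inner h1) t).continuousAt

theorem norm_iteratedIntegral_le (hm : Continuous m) {C : ℝ} (hC : ∀ t, ‖m t‖ ≤ C) (k : ℕ)
    (t : ℝ) : ‖iteratedIntegral m k t‖ ≤ (C * |t|) ^ (2 * k) / (2 * k).factorial := by
  have hC0 : 0 ≤ C := (norm_nonneg _).trans (hC 0)
  induction k generalizing t with
  | zero => simp [iteratedIntegral]
  | succ k ih =>
    have hJ := (continuous_iteratedIntegral hm k).smul hm
    have h1 : ∀ s, ‖∫ r in (0 : ℝ)..s, iteratedIntegral m k r • m r‖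
        ≤ C ^ (2 * k + 1) / (2 * k).factorial * (|s| ^ (2 * k + 1) / ((2 * k : ℕ) + 1)) := by
      refine norm_integral_le_pow hJ fun r => ?_
      rw [norm_smul]
      refine (mul_le_mul (ih r) (hC r) (norm_nonneg _) (by positivity)).trans_eq ?_
      rw [mul_pow]
      ring
    have h1c : Continuous fun s => ∫ r in (0 : ℝ)..s, iteratedIntegral m k r • m r :=
      continuous_iff_continuousAt.2 fun t => (hasDerivAt_integral_of_continuous hJ t).continuousAt
    -- The outer integrand gains one more factor `C` from `m s`, and `(2k)!` times the `2k + 1` from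
    -- the inner integral gives `(2k + 1)!`.
    have h2 := norm_integral_le_pow (A := C ^ (2 * k + 2) / (2 * k + 1).factorial)
      (n := 2 * k + 1) (hm.inner h1c (𝕜 := ℂ)) (fun s => ?_) t
    · refine h2.trans_eq ?_
      rw [show 2 * (k + 1) = 2 * k + 1 + 1 by ring, Nat.factorial_succ (2 * k + 1), mul_pow]
      push_cast
      field_simp
    · refine (norm_inner_le_norm _ _).trans
        ((mul_le_mul (hC s) (h1 s) (norm_nonneg _) hC0).trans_eq ?_)
      rw [Nat.factorial_succ (2 * k)]
      push_cast
      field_simp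
      ring

theorem summable_even_pow_div_factorial (x : ℝ) :
    Summable fun k : ℕ => x ^ (2 * k) / (2 * k).factorial :=
  (Real.summable_pow_div_factorial x).comp_injective
    (i := fun k : ℕ => 2 * k) fun _ _ h => Nat.eq_of_mul_eq_mul_left two_pos h

theorem norm_amplitude_term_le (hm : Continuous m) {C : ℝ} (hC : ∀ t, ‖m t‖ ≤ C) (k : ℕ)
    {r T : ℝ} (hr : |r| ≤ T) :
    ‖(-1) ^ k * iteratedIntegral m k r‖ ≤ (C * T) ^ (2 * k) / (2 * k).factorial := by
  have hC0 : 0 ≤ C := (norm_nonneg _).trans (hC 0)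
  rw [norm_mul, norm_pow, norm_neg, norm_one, one_pow, one_mul]
  refine (norm_iteratedIntegral_le hm hC k r).trans ?_
  gcongr

theorem hasSum_amplitude (hm : Continuous m) {C : ℝ} (hC : ∀ t, ‖m t‖ ≤ C) (t : ℝ) :
    HasSum (fun k : ℕ => (-1) ^ k * iteratedIntegral m k t) (amplitude m t) :=
  (Summable.of_norm_bounded (summable_even_pow_div_factorial (C * |t|))
    fun k => norm_amplitude_term_le hm hC k le_rfl).hasSum

theorem continuous_amplitude (hm : Continuous m) {C : ℝ} (hC : ∀ t, ‖m t‖ ≤ C) :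
    Continuous (amplitude m) := by
  refine continuous_iff_continuousAt.2 fun t => ?_
  -- The Weierstrass test applies only on bounded sets; the radius `|t| + 1` makes `t` an interior
  -- point.
  have h : ContinuousOn (amplitude m) (Metric.closedBall 0 (|t| + 1)) := by
    refine continuousOn_tsum (fun k =>
      (continuous_const.mul (continuous_iteratedIntegral hm k)).continuousOn)
      (summable_even_pow_div_factorial (C * (|t| + 1))) fun k r hr =>
        norm_amplitude_term_le hm hC k ?_
    simpa using hr
  exact h.continuousAt (Filter.mem_of_superset (Metric.isOpen_ball.mem_nhds (by simp))
    Metric.ball_subset_closedBall)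

theorem hasDerivAt_emitted (hm : Continuous m) {C : ℝ} (hC : ∀ t, ‖m t‖ ≤ C) (t : ℝ) :
    HasDerivAt (emitted m) (amplitude m t • m t) t :=
  hasDerivAt_integral_of_continuous ((continuous_amplitude hm hC).smul hm) t

theorem continuous_emitted (hm : Continuous m) {C : ℝ} (hC : ∀ t, ‖m t‖ ≤ C) :
    Continuous (emitted m) :=
  continuous_iff_continuousAt.2 fun t => (hasDerivAt_emitted hm hC t).continuousAt

/-- The Volterra equation of the amplitude. -/
theorem amplitude_eq (hm : Continuous m) {C : ℝ} (hC : ∀ t, ‖m t‖ ≤ C) (t : ℝ) :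
    amplitude m t = 1 - ∫ s in (0 : ℝ)..t, inner ℂ (m s) (emitted m s) := by
  have hC0 : 0 ≤ C := (norm_nonneg _).trans (hC 0)
  have hJ := continuous_iteratedIntegral hm
  -- The signed contributions to the emitted packet. Summing them under the inner integral gives
  -- `emitted`, and a second termwise integration gives the tail of the amplitude series with its
  -- sign reversed.
  set w : ℕ → ℝ → F := fun k s => ∫ r in (0 : ℝ)..s, ((-1) ^ k * iteratedIntegral m k r) • m r
    with hw
  have hwc : ∀ k, Continuous (w k) := fun k => continuous_iff_continuousAt.2 fun t =>
    (hasDerivAt_integral_of_continuous ((continuous_const.mul (hJ k)).smul hm) t).continuousAt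
  have hwb : ∀ T k r, |r| ≤ T →
      ‖((-1) ^ k * iteratedIntegral m k r) • m r‖
        ≤ (C * T) ^ (2 * k) / (2 * k).factorial * C := by
    intro T k r hr
    rw [norm_smul]
    exact mul_le_mul (norm_amplitude_term_le hm hC k hr) (hC r) (norm_nonneg _)
      (div_nonneg (Even.pow_nonneg (even_two_mul k) _) (Nat.cast_nonneg _))
  have h1 : ∀ s, HasSum (fun k => w k s) (emitted m s) := fun s =>
    hasSum_integral_of_norm_le (fun k => (continuous_const.mul (hJ k)).smul hm)
      ((summable_even_pow_div_factorial (C * |s|)).mul_right C) (hwb |s|)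
      fun r => (hasSum_amplitude hm hC r).smul_const (m r)
  have h2 : HasSum (fun k => ∫ s in (0 : ℝ)..t, inner ℂ (m s) (w k s))
      (∫ s in (0 : ℝ)..t, inner ℂ (m s) (emitted m s)) := by
    refine hasSum_integral_of_norm_le (fun k => hm.inner (hwc k))
      (((summable_even_pow_div_factorial (C * |t|)).mul_right C).mul_right (C * |t|))
      (fun k s hs => ?_) fun s => (h1 s).mapL (innerSL ℂ (m s))
    -- A bound linear in the length of the interval suffices here; it only costs a constant factor
    -- in the summable majorant.
    have h3 : ‖w k s‖ ≤ (C * |t|) ^ (2 * k) / (2 * k).factorial * C * |s - 0| := by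
      refine intervalIntegral.norm_integral_le_of_norm_le_const fun r hr => hwb _ k r ?_
      have h := Set.abs_sub_left_of_mem_uIcc (Set.uIoc_subset_uIcc hr)
      simp only [sub_zero] at h
      exact h.trans hs
    rw [sub_zero] at h3
    have h4 := (norm_nonneg _).trans (hwb |t| k 0 (by simp))
    calc ‖inner ℂ (m s) (w k s)‖ ≤ ‖m s‖ * ‖w k s‖ := norm_inner_le_norm _ _
      _ ≤ C * ((C * |t|) ^ (2 * k) / (2 * k).factorial * C * |t|) :=
        mul_le_mul (hC s) (h3.trans (by gcongr)) (norm_nonneg _) hC0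
      _ = _ := by ring
  have h5 : ∀ k, (-1) ^ (k + 1) * iteratedIntegral m (k + 1) t
      = -∫ s in (0 : ℝ)..t, inner ℂ (m s) (w k s) := by
    intro k
    have h6 : ∀ s, w k s = ((-1) ^ k : ℂ) • ∫ r in (0 : ℝ)..s, iteratedIntegral m k r • m r := by
      intro s
      simp only [hw, mul_smul]
      exact intervalIntegral.integral_smul _ _
    simp only [h6, inner_smul_right]
    rw [intervalIntegral.integral_const_mul, pow_succ, iteratedIntegral]
    ring
  -- Removing the term `k = 0`, which equals `1`, shifts the index so that `h5` applies.
  have h7 := (hasSum_nat_add_iff' 1).2 (hasSum_amplitude hm hC t)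
  simp only [h5] at h7
  have h8 := h7.unique h2.neg
  simp only [Finset.range_one, Finset.sum_singleton, pow_zero, one_mul] at h8
  have h9 : iteratedIntegral m 0 t = 1 := rfl
  rw [h9] at h8
  rw [sub_eq_iff_eq_add'.1 h8, sub_eq_add_neg]

theorem hasDerivAt_amplitude (hm : Continuous m) {C : ℝ} (hC : ∀ t, ‖m t‖ ≤ C) (t : ℝ) :
    HasDerivAt (amplitude m) (-inner ℂ (m t) (emitted m t)) t := by
  have h := (hasDerivAt_integral_of_continuous
    (hm.inner (𝕜 := ℂ) (continuous_emitted hm hC)) t).const_sub 1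
  exact h.congr_of_eventuallyEq (Filter.Eventually.of_forall fun t => amplitude_eq hm hC t)

/-- Both satisfy the same recursion once the inner integral is pulled through `⟨m s, ·⟩`.
Nonnegative time is needed: for `t < 0` and `k ≥ 1` the simplex is empty, whereas the iterated
integrals are oriented and so give two-sided derivatives at `0`. -/
theorem orderedIntegral_eq_iteratedIntegral (hm : Continuous m) (k : ℕ) {t : ℝ} (ht : 0 ≤ t) :
    orderedIntegral (fun t s => inner ℂ (m t) (m s)) k t = iteratedIntegral m k t := by
  have hK : Continuous fun p : ℝ × ℝ => inner ℂ (m p.1) (m p.2) :=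
    (hm.comp continuous_fst).inner (hm.comp continuous_snd)
  induction k generalizing t with
  | zero => exact orderedIntegral_zero _ t
  | succ k ih =>
    rw [orderedIntegral_succ hK k ht, iteratedIntegral]
    refine intervalIntegral.integral_congr fun s hs => ?_
    rw [Set.uIcc_of_le ht] at hs
    have h1 := (innerSL ℂ (m s)).intervalIntegral_comp_comm (μ := volume) (a := 0) (b := s)
      (((continuous_iteratedIntegral hm k).smul hm).intervalIntegrable _ _)
    refine Eq.trans ?_ h1
    refine intervalIntegral.integral_congr fun r hr => ?_
    rw [Set.uIcc_of_le hs.1] at hr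
    simp only [ih hr.1, innerSL_apply_apply, Pi.smul_apply', inner_smul_right]
    ring

theorem lam_eq_amplitude (hm : Continuous m) {t : ℝ} (ht : 0 ≤ t) :
    lam (fun t s => inner ℂ (m t) (m s)) t = amplitude m t :=
  tsum_congr fun k => by rw [orderedIntegral_eq_iteratedIntegral hm k ht]

end Amplitude

/-! ### The one-excitation dynamics -/

section Dynamics

variable {F : Type u} [NormedAddCommGroup F] [InnerProductSpace ℂ F]

/-- An eigenvector of `A` is an eigenvector of `exp A`. -/
theorem exp_apply_of_apply_eq_smul {S : Type*} [NormedAddCommGroup S] [NormedSpace ℂ S]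
    [CompleteSpace S] {A : S →L[ℂ] S} {x : S} {c : ℂ} (h : A x = c • x) :
    NormedSpace.exp A x = Complex.exp c • x := by
  have hpow : ∀ n : ℕ, (A ^ n) x = c ^ n • x := by
    intro n
    induction n with
    | zero => simp
    | succ n ih => rw [pow_succ, mul_apply_eq_comp, h, map_smul, ih, smul_smul, pow_succ']
  have h1 := (NormedSpace.exp_series_hasSum_exp' (𝕂 := ℂ) A).mapL
    (ContinuousLinearMap.apply ℂ S x)
  have h2 := (NormedSpace.exp_series_hasSum_exp' (𝕂 := ℂ) c).smul_const x
  rw [← Complex.exp_eq_exp_ℂ] at h2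
  refine h1.unique (h2.congr_fun fun n => ?_)
  simp [hpow, smul_smul]

theorem freeEvolution_tmul {S : Type*} [NormedAddCommGroup S] [InnerProductSpace ℂ S]
    [CompleteSpace S] (H : S →L[ℂ] S) (V : UnitaryGroup F) (t : ℝ) {s : S} {E : ℂ} (hs : H s = E • s)
    (x : Fock F) :
    freeEvolution H V t (s ⊗ₜ[ℂ] x) = (Complex.exp (Complex.I * t * E) • s) ⊗ₜ[ℂ] V.fock t x := by
  have h : ((Complex.I * t) • H) s = (Complex.I * t * E) • s := by
    rw [smul_apply, hs, smul_smul]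
  rw [← exp_apply_of_apply_eq_smul h]
  rfl

theorem hybridWave_add {S : Type*} [NormedAddCommGroup S] [InnerProductSpace ℂ S]
    (Ψ Ψ' : S ⊗[ℂ] Fock F) (f : F) :
    hybridWave (Ψ + Ψ') f = hybridWave Ψ f + hybridWave Ψ' f := by
  simp [hybridWave]

theorem hybridWave_tmul {S : Type*} [NormedAddCommGroup S] [InnerProductSpace ℂ S] (s : S) (x : Fock F) (f : F) :
    hybridWave (s ⊗ₜ[ℂ] x) f = inner ℂ (expVec f) x • s := by
  simp [hybridWave]

theorem continuous_mode (V : UnitaryGroup F) (ω₀ : ℝ) (g : F) : Continuous (mode V ω₀ g) :=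
  Continuous.smul (by fun_prop) (V.continuous' g)

theorem norm_mode_le (V : UnitaryGroup F) (ω₀ : ℝ) (g : F) (t : ℝ) : ‖mode V ω₀ g t‖ ≤ ‖g‖ := by
  have h : -(Complex.I * ω₀ * t) = ((-(ω₀ * t) : ℝ) : ℂ) * Complex.I := by
    push_cast; ring
  rw [mode, norm_smul, h, Complex.norm_exp_ofReal_mul_I, one_mul, LinearIsometry.norm_map]

theorem hasDerivAt_phase (ω₀ t : ℝ) :
    HasDerivAt (fun t : ℝ => Complex.exp (-(Complex.I * ω₀ * t)))
      (-(Complex.I * ω₀) * Complex.exp (-(Complex.I * ω₀ * t))) t := by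
  have h1 : HasDerivAt (fun t : ℝ => -(Complex.I * ω₀ * t)) (-(Complex.I * ω₀)) t := by
    simpa using (hasDerivAt_id t).ofReal_comp.const_mul (Complex.I * ω₀) |>.fun_neg
  rw [mul_comm (-_)]
  exact h1.cexp

variable [CompleteSpace F] (V : UnitaryGroup F) (ω₀ : ℝ) (g : F)

/-- This is the excited-state amplitude in the Schrödinger picture. The phase cancels the one in
`mode`, turning `⟨g_t|η_t⟩` into `⟨g|V(-t) η_t⟩`. -/
theorem hasDerivAt_amplitude_mul_phase (t : ℝ) :
    HasDerivAt (fun t : ℝ => amplitude (mode V ω₀ g) t * Complex.exp (-(Complex.I * ω₀ * t)))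
      (-inner ℂ g (V (-t) (emitted (mode V ω₀ g) t))
        - Complex.I * ω₀ * (amplitude (mode V ω₀ g) t * Complex.exp (-(Complex.I * ω₀ * t)))) t := by
  have h := (hasDerivAt_amplitude (continuous_mode V ω₀ g) (norm_mode_le V ω₀ g) t).mul
    (hasDerivAt_phase ω₀ t)
  have h1 : inner ℂ (mode V ω₀ g t) (emitted (mode V ω₀ g) t) * Complex.exp (-(Complex.I * ω₀ * t))
      = inner ℂ g (V (-t) (emitted (mode V ω₀ g) t)) := by
    rw [V.inner_neg_apply, mode, inner_smul_left, ← Complex.exp_conj, mul_right_comm,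
      ← Complex.exp_add]
    simp
  refine HasDerivAt.congr_deriv h ?_
  rw [← h1]
  ring

/-- The packet is the orbit of `g` averaged with the weight `λ(r) e^{-iω₀r}`, which is continuously
differentiable by the Volterra equation. No regularity of `g` is required. -/
theorem emitted_mem_domain (t : ℝ) : emitted (mode V ω₀ g) t ∈ V.generator.domain := by
  have hc : Continuous fun t : ℝ => -inner ℂ g (V (-t) (emitted (mode V ω₀ g) t))
      - Complex.I * ω₀ * (amplitude (mode V ω₀ g) t * Complex.exp (-(Complex.I * ω₀ * t))) := by
    have h1 := continuous_amplitude (continuous_mode V ω₀ g) (norm_mode_le V ω₀ g)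
    have h2 := continuous_emitted (continuous_mode V ω₀ g) (norm_mode_le V ω₀ g)
    simp only [V.inner_neg_apply]
    have h3 := (V.continuous' g).inner (𝕜 := ℂ) h2
    fun_prop
  have h := V.integral_mem_domain g (hasDerivAt_amplitude_mul_phase V ω₀ g) hc t
  simp only [mul_smul] at h
  exact h

/-- The emitted wave packet in the Schrödinger picture solves the one-particle Schrödinger equation
with source. -/
theorem hasDerivAt_neg_apply_emitted (t : ℝ) :
    ∃ hx : V (-t) (emitted (mode V ω₀ g) t) ∈ V.generator.domain,
      HasDerivAt (fun t => V (-t) (emitted (mode V ω₀ g) t))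
        ((amplitude (mode V ω₀ g) t * Complex.exp (-(Complex.I * ω₀ * t))) • g
          - Complex.I • V.generator ⟨_, hx⟩) t := by
  obtain ⟨hx, h⟩ := V.exists_generator_apply ⟨_, emitted_mem_domain V ω₀ g t⟩ (-t)
  refine ⟨hx, ?_⟩
  -- The product rule needs the packet at the frozen time `t` to be in the domain; the source term
  -- is `V (-t)` applied to `λ(t) g_t`, that is `λ(t) e^{-iω₀t} g`.
  have h1 := hasDerivAt_isometry_apply (U := fun t => V (-t))
    (fun x => (V.continuous' x).comp continuous_neg)
    (hasDerivAt_emitted (continuous_mode V ω₀ g) (norm_mode_le V ω₀ g) t)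
    (V.hasDerivAt_neg_apply ⟨_, emitted_mem_domain V ω₀ g t⟩ t)
  refine HasDerivAt.congr_deriv h1 ?_
  rw [h, sub_eq_add_neg, map_smul, mode, map_smul, ← V.add_apply, neg_add_cancel, V.zero_apply,
    smul_smul]

variable {S : Type*} [NormedAddCommGroup S] [InnerProductSpace ℂ S]

/-- The Schrödinger picture state at time `t` that starts from `(a gnd + b exc) ⊗ vac`. -/
def jcState (gnd exc : S) (a b : ℂ) (t : ℝ) : S ⊗[ℂ] Fock F :=
  gnd ⊗ₜ[ℂ] (a • vac F + oneParticle F (b • V (-t) (emitted (mode V ω₀ g) t)))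
    + exc ⊗ₜ[ℂ] ((b * (amplitude (mode V ω₀ g) t * Complex.exp (-(Complex.I * ω₀ * t)))) • vac F)

variable [CompleteSpace S] {gnd exc : S}

theorem jcState_isSchrodingerSolution (hortho : Orthonormal ℂ ![gnd, exc]) (a b : ℂ) :
    IsSchrodingerSolution (jcHamiltonian gnd exc ω₀ V g)
      ((a • gnd + b • exc) ⊗ₜ[ℂ] vac F) (jcState V ω₀ g gnd exc a b) := by
  constructor
  · have h1 : emitted (mode V ω₀ g) 0 = 0 := intervalIntegral.integral_same
    have h2 : amplitude (mode V ω₀ g) 0 = 1 := by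
      rw [amplitude_eq (continuous_mode V ω₀ g) (norm_mode_le V ω₀ g),
        intervalIntegral.integral_same, sub_zero]
    simp [jcState, h1, h2, TensorProduct.add_tmul, TensorProduct.smul_tmul]
  · intro t _
    obtain ⟨hx, hd⟩ := hasDerivAt_neg_apply_emitted V ω₀ g t
    obtain ⟨h, e⟩ := jcHamiltonian_apply hortho ω₀ V g a
      (b * (amplitude (mode V ω₀ g) t * Complex.exp (-(Complex.I * ω₀ * t)))) (b • ⟨_, hx⟩)
    refine ⟨h, ?_⟩
    -- The component `a • vac` is stationary: the ground state has energy zero and does not couple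
    -- to the vacuum.
    have h1 := hasDerivAt_clm_comp (TensorProduct.mkL ℂ S (Fock F) gnd) ((hasDerivAt_linearIsometry_comp (oneParticle F)
      (hd.const_smul b)).const_add (a • vac F))
    have h2 := hasDerivAt_clm_comp (TensorProduct.mkL ℂ S (Fock F) exc)
      (((hasDerivAt_amplitude_mul_phase V ω₀ g t).const_mul b).smul_const (vac F))
    have h3 := (h1.add h2).hasDerivWithinAt (s := Set.Ici 0)
    refine HasDerivWithinAt.congr_deriv h3 ?_
    refine Eq.trans ?_ (congrArg ((-Complex.I) • ·) e).symm
    rw [smul_add, ← TensorProduct.tmul_smul, ← TensorProduct.tmul_smul, ← map_smul, smul_smul,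
      LinearPMap.map_smul]
    refine congrArg₂ (· + ·) (congrArg (fun x => gnd ⊗ₜ[ℂ] oneParticle F x) ?_)
      (congrArg (fun z : ℂ => exc ⊗ₜ[ℂ] (z • vac F)) ?_)
    · have h4 : ∀ z : ℂ, -Complex.I * (Complex.I * z) = z := fun z => by
        linear_combination (-z) * Complex.I_mul_I
      rw [smul_sub, smul_add, smul_smul, smul_smul, smul_smul, smul_smul, h4]
      module
    · rw [Submodule.coe_smul, inner_smul_right]
      linear_combination (-(b * inner ℂ g (V (-t) (emitted (mode V ω₀ g) t)))) * Complex.I_mul_I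

end Dynamics

end

end OpenQS

/-- Exact solution of the Jaynes–Cummings model. Here `gnd`, `exc` are the ground and excited
states of the two-level atom, `h` is the one-particle Hamiltonian of the bath, `V t = e^{ith}`,
`Φ t = e^{-itH_Tot} (φ ⊗ vac)` is the state in the Schrödinger picture, and
`freeEvolution (ω₀ |e⟩⟨e|) V t (Φ t) = e^{itH₀} e^{-itH_Tot} (φ ⊗ vac)` is the state in the
interaction picture. -/
theorem mainTheorem4 {S F : Type*}
    [NormedAddCommGroup S] [InnerProductSpace ℂ S] [CompleteSpace S]
    [NormedAddCommGroup F] [InnerProductSpace ℂ F] [CompleteSpace F]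
    (gnd exc : S) (hortho : Orthonormal ℂ ![gnd, exc]) (hspan : Submodule.span ℂ {gnd, exc} = ⊤)
    (ω₀ : ℝ) (h : F →ₗ.[ℂ] F) (hh : IsSelfAdjoint h)
    (V : UnitaryGroup F) (hV : V.generator = h) (g : F) (φ : S) :
    ∃ Φ : ℝ → S ⊗[ℂ] Fock F,
      -- the state is the unique solution of the Schrödinger equation starting from `φ ⊗ vac` …
      IsSchrodingerSolution (jcHamiltonian gnd exc ω₀ V g) (φ ⊗ₜ[ℂ] vac F) Φ ∧
      (∀ Φ' : ℝ → S ⊗[ℂ] Fock F,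
        IsSchrodingerSolution (jcHamiltonian gnd exc ω₀ V g) (φ ⊗ₜ[ℂ] vac F) Φ' →
        ∀ t, 0 ≤ t → Φ' t = Φ t) ∧
      -- … and is given by the unitary group `W t = e^{itH_Tot}`
      (∀ W : UnitaryGroup (S ⊗[ℂ] Fock F), jcHamiltonian gnd exc ω₀ V g ≤ W.generator →
        ∀ t, 0 ≤ t → W (-t) (φ ⊗ₜ[ℂ] vac F) = Φ t) ∧
      ∀ t, 0 ≤ t →
        -- all the integrals and the series in the formula converge
        (∀ k : ℕ, MeasureTheory.IntegrableOn (kernelProduct (kernel V ω₀ g) k)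
          (timeSimplex (2 * k) t)) ∧
        (Summable fun k : ℕ => (-1) ^ k * orderedIntegral (kernel V ω₀ g) k t) ∧
        ∀ f : F,
          IntervalIntegrable (fun τ => trajectory V ω₀ g f τ * lam (kernel V ω₀ g) τ)
            MeasureTheory.volume 0 t ∧
          hybridWave (freeEvolution ((ω₀ : ℂ) • InnerProductSpace.rankOne ℂ exc exc) V t (Φ t)) f
            = φ + inner ℂ exc φ •
              ((lam (kernel V ω₀ g) t - 1) • exc +
                (∫ τ in (0 : ℝ)..t, trajectory V ω₀ g f τ * lam (kernel V ω₀ g) τ) • gnd) := by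
  have hge : inner ℂ exc gnd = 0 := by simpa using hortho.2 (i := 1) (j := 0) (by simp)
  have hee : inner ℂ exc exc = 1 := by
    rw [inner_self_eq_norm_sq_to_K, show ‖exc‖ = 1 from hortho.1 1]
    simp
  obtain ⟨a, b, rfl⟩ : ∃ a b : ℂ, a • gnd + b • exc = φ :=
    Submodule.mem_span_pair.1 (hspan ▸ Submodule.mem_top)
  have hb : inner ℂ exc (a • gnd + b • exc) = b := by
    rw [inner_add_right, inner_smul_right, inner_smul_right, hge, hee, mul_zero, mul_one, zero_add]
  have hm := continuous_mode V ω₀ g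
  have hC := norm_mode_le V ω₀ g
  have hsol := jcState_isSchrodingerSolution V ω₀ g hortho a b
  have hsymm := totalHamiltonian_isFormalAdjoint (isSelfAdjoint_smul_rankOne ω₀ exc)
    (InnerProductSpace.rankOne ℂ gnd exc) V g
  -- The series `lam` agrees with `amplitude` only for nonnegative times; calculus is done with the
  -- latter, which is smooth across `0`.
  have hlam : ∀ t, 0 ≤ t → lam (kernel V ω₀ g) t = amplitude (mode V ω₀ g) t :=
    fun t ht => lam_eq_amplitude hm ht
  have hK : Continuous fun p : ℝ × ℝ => kernel V ω₀ g p.1 p.2 :=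
    (hm.comp continuous_fst).inner (hm.comp continuous_snd)
  refine ⟨jcState V ω₀ g gnd exc a b, hsol, fun Φ' hΦ' => hΦ'.eqOn hsymm hsol, ?_, ?_⟩
  · intro W hW
    -- The solution at time `0` places `φ ⊗ vac` in the domain of the generator of `W`. The orbit of
    -- `W` and `jcState` then both solve the equation of that symmetric generator.
    have h0 := (hsol.mono hW).2 0 le_rfl
    rw [hsol.1] at h0
    exact (W.isSchrodingerSolution ⟨_, h0.1⟩).eqOn W.generator_isFormalAdjoint (hsol.mono hW)
  · intro t ht
    refine ⟨fun k => (continuous_kernelProduct hK k).integrableOn_timeSimplex t, ?_, fun f => ?_⟩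
    · refine (hasSum_amplitude hm hC t).summable.congr fun k => ?_
      rw [← orderedIntegral_eq_iteratedIntegral hm k ht]
      rfl
    · have hc : Continuous fun τ => trajectory V ω₀ g f τ * amplitude (mode V ω₀ g) τ :=
        (continuous_const.inner hm).mul (continuous_amplitude hm hC)
      have heq : Set.EqOn (fun τ => trajectory V ω₀ g f τ * amplitude (mode V ω₀ g) τ)
          (fun τ => trajectory V ω₀ g f τ * lam (kernel V ω₀ g) τ) (Set.uIcc 0 t) := by
        intro τ hτ
        rw [Set.uIcc_of_le ht] at hτ
        simp only [hlam τ hτ.1]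
      refine ⟨(hc.intervalIntegrable 0 t).congr (heq.mono Set.uIoc_subset_uIcc), ?_⟩
      have hint : ∫ τ in (0 : ℝ)..t, trajectory V ω₀ g f τ * lam (kernel V ω₀ g) τ
          = inner ℂ f (emitted (mode V ω₀ g) t) := by
        rw [← intervalIntegral.integral_congr heq]
        refine Eq.trans ?_ ((innerSL ℂ f).intervalIntegral_comp_comm
          (((continuous_amplitude hm hC).smul hm).intervalIntegrable 0 t))
        refine intervalIntegral.integral_congr fun τ _ => ?_
        simp only [innerSL_apply_apply, inner_smul_right, trajectory]
        ring
      have h1 : ((ω₀ : ℂ) • InnerProductSpace.rankOne ℂ exc exc) gnd = (0 : ℂ) • gnd := by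
        simp [hge]
      have h2 : ((ω₀ : ℂ) • InnerProductSpace.rankOne ℂ exc exc) exc = (ω₀ : ℂ) • exc := by
        rw [smul_apply, InnerProductSpace.rankOne_apply, hee, one_smul]
      -- The free evolution multiplies the excited component by `e^{iω₀t}` and applies `V t` to the
      -- emitted boson, undoing exactly the factors that define `jcState`.
      have hphase : Complex.exp (-(Complex.I * ω₀ * t)) * Complex.exp (Complex.I * t * ω₀) = 1 := by
        rw [← Complex.exp_add, show -(Complex.I * ω₀ * t) + Complex.I * t * ω₀ = 0 by ring,
          Complex.exp_zero]
      have hcoef : b * (amplitude (mode V ω₀ g) t * Complex.exp (-(Complex.I * ω₀ * t)))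
          * Complex.exp (Complex.I * t * ω₀) = b * amplitude (mode V ω₀ g) t := by
        linear_combination (b * amplitude (mode V ω₀ g) t) * hphase
      rw [hint, hlam t ht, hb, jcState, map_add, freeEvolution_tmul _ V t h1,
        freeEvolution_tmul _ V t h2, hybridWave_add, hybridWave_tmul, hybridWave_tmul]
      simp only [map_add, map_smul, fock_vac, fock_oneParticle, V.apply_neg_apply,
        inner_add_right, inner_smul_right, inner_expVec_vac, inner_expVec_oneParticle, mul_zero,
        Complex.exp_zero, one_smul, mul_one, smul_smul, hcoef]
      module
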